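/- Let $C$ be an Abelian von Neumann algebra. A \emph{normal representable $C$-bimodule} is a Banach $C$-bimodule $X$ for which there exist Hilbert spaces $\mathcal H,\mathcal K$ with normal $*$-representations $\pi:C\to \mathrm B(\mathcal H)$, $\sigma:C\to \mathrm B(\mathcal K)$ and a linear isometry $T:X\to \mathrm B(\mathcal K,\mathcal H)$ such that $T(cx)=\pi(c)T(x)$ and $T(xc)=T(x)\sigma(c)$ for all $c\in C$, $x\in X$. Let $\mathrm{CNRM}_C$ be the class of all such bimodules that are central, that is, $cx=xc$ for all $c\in C$, $x\in X$. For $X,Y\in\mathrm{CNRM}_C$ and $w$ in the algebraic tensor product $X\otimes_C Y$ put $$\nu_C(w)=\sup\|\phi(w)\|,$$ where the supremum is over all $C$-bilinear contractions $\phi$ from $X\times Y$ into normal representable $C$-bimodules and $\phi(\sum_j x_j\otimes_C y_j)=\sum_j\phi(x_j,y_j)$. Let $X\stackrel{\nu}{\otimes}_C Y$ be the completion of $X\otimes_C Y$ with respect to $\nu_C$. \textbf{Proposition.} Let $X,Y\in\mathrm{CNRM}_C$. Then: (1) $X\stackrel{\nu}{\otimes}_C Y\in\mathrm{CNRM}_C$.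 (2) For each $Z\in\mathrm{CNRM}_C$ and each bounded $C$-bilinear map $\psi:X\times Y\to Z$ there exists a unique bounded $C$-module map $\tilde\psi:X\stackrel{\nu}{\otimes}_C Y\to Z$ such that $\tilde\psi(x\otimes_C y)=\psi(x,y)$ for all $x\in X$, $y\in Y$; moreover $\|\tilde\psi\|=\|\psi\|$. (3) $\nu_C$ is a norm, and it is the largest among the norms $\|\cdot\|$ on $X\otimes_C Y$ such that $\|x\otimes_C y\|\le\|x\|\,\|y\|$ for all $x\in X$, $y\in Y$ and such that the completion of $X\otimes_C Y$ with respect to $\|\cdot\|$ is a normal representable $C$-bimodule. -/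

import Mathlib

open scoped TensorProduct

universe u

section Representable

/-- A (unital) `*`-representation `π` of `C` on a Hilbert space `H` is normal when it preserves
suprema of bounded increasing nets of self-adjoint elements: for each nonempty directed set `D` of
self-adjoint elements with supremum `a` in `C`, `π a` is the supremum of `π '' D` in `B(H)`
(with the usual order of operators). -/
def IsNormalRep {C : Type u} [CStarAlgebra C] [PartialOrder C]
    {H : Type u} [NormedAddCommGroup H] [InnerProductSpace ℂ H] [CompleteSpace H]
    (π : C →⋆ₐ[ℂ] (H →L[ℂ] H)) : Prop :=
  ∀ (D : Set C) (a : C), (∀ d ∈ D, IsSelfAdjoint d) → D.Nonempty → DirectedOn (· ≤ ·) D →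
    IsLUB D a → IsLUB (π '' D) (π a)

/-- The Banach space `X` with commuting left and right actions of `C` (the right action is an
action of `Cᵐᵒᵖ`) is a normal representable `C`-bimodule: there are normal Hilbert modules
`(H, π)`, `(K, σ)` over `C` and a linear isometry `T` of `X` into `B(K, H)` with
`T (c x) = π(c) T(x)` and `T (x c) = T(x) σ(c)`.
(Such an isometry forces `‖c x‖ ≤ ‖c‖ ‖x‖` and `‖x c‖ ≤ ‖x‖ ‖c‖`.) -/
def IsNormalRepresentable (C : Type u) [CStarAlgebra C] [PartialOrder C]
    (X : Type u) [NormedAddCommGroup X] [NormedSpace ℂ X] [CompleteSpace X]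
    [Module C X] [Module Cᵐᵒᵖ X] : Prop :=
  ∃ (H : Type u) (_ : NormedAddCommGroup H) (_ : InnerProductSpace ℂ H) (_ : CompleteSpace H)
    (K : Type u) (_ : NormedAddCommGroup K) (_ : InnerProductSpace ℂ K) (_ : CompleteSpace K)
    (π : C →⋆ₐ[ℂ] (H →L[ℂ] H)) (σ : C →⋆ₐ[ℂ] (K →L[ℂ] K)) (T : X →ₗᵢ[ℂ] (K →L[ℂ] H)),
    IsNormalRep π ∧ IsNormalRep σ ∧
      ∀ (c : C) (x : X), T (c • x) = (π c) ∘L (T x) ∧ T (MulOpposite.op c • x) = (T x) ∘L (σ c)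

end Representable

section Tensor

set_option linter.unusedSectionVars false

variable (C : Type u) [CommCStarAlgebra C] [PartialOrder C]
variable (X : Type u) [NormedAddCommGroup X] [NormedSpace ℂ X]
  [Module C X] [IsScalarTower ℂ C X] [Module Cᵐᵒᵖ X] [IsCentralScalar C X]
variable (Y : Type u) [NormedAddCommGroup Y] [NormedSpace ℂ Y]
  [Module C Y] [IsScalarTower ℂ C Y] [Module Cᵐᵒᵖ Y] [IsCentralScalar C Y]

/-- The numbers `‖φ(w)‖`, where `φ` runs over the `C`-bilinear contractions from `X × Y` into
normal representable `C`-bimodules `Z` (not necessarily central), and `φ(w)` is the value at `w`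
of the linear map on `X ⊗_C Y` induced by `φ`. Here `C`-bilinear means `φ(c x, y) = c φ(x, y)`,
`φ(x c, y) = φ(x, c y)` and `φ(x, y c) = φ(x, y) c`. -/
def nuValues (w : X ⊗[C] Y) : Set ℝ :=
  {r | ∃ (Z : Type u) (_ : NormedAddCommGroup Z) (_ : NormedSpace ℂ Z) (_ : CompleteSpace Z)
    (_ : Module C Z) (_ : IsScalarTower ℂ C Z) (_ : Module Cᵐᵒᵖ Z) (_ : IsScalarTower ℂ Cᵐᵒᵖ Z)
    (_ : SMulCommClass C Cᵐᵒᵖ Z) (φ : X →ₗ[C] Y →ₗ[C] Z),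
    IsNormalRepresentable C Z ∧
    (∀ (c : C) (x : X) (y : Y), φ x (MulOpposite.op c • y) = MulOpposite.op c • φ x y) ∧
    (∀ (x : X) (y : Y), ‖φ x y‖ ≤ ‖x‖ * ‖y‖) ∧
    r = ‖TensorProduct.lift φ w‖}

variable {C X Y}

theorem nuValues_bddAbove (w : X ⊗[C] Y) : BddAbove (nuValues C X Y w) := by
  suffices h : ∃ M : ℝ, ∀ r ∈ nuValues C X Y w, r ≤ M by
    obtain ⟨M, hM⟩ := h
    exact ⟨M, hM⟩
  induction w using TensorProduct.induction_on with
  | zero =>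
    refine ⟨0, ?_⟩
    rintro r ⟨Z, _, _, _, _, _, _, _, _, φ, -, -, -, rfl⟩
    simp
  | tmul x y =>
    refine ⟨‖x‖ * ‖y‖, ?_⟩
    rintro r ⟨Z, _, _, _, _, _, _, _, _, φ, -, -, h, rfl⟩
    simpa using h x y
  | add v w hv hw =>
    obtain ⟨M, hM⟩ := hv
    obtain ⟨N, hN⟩ := hw
    refine ⟨M + N, ?_⟩
    rintro r ⟨Z, i1, i2, i3, i4, i5, i6, i7, i8, φ, h1, h2, h3, rfl⟩
    rw [map_add]
    exact (norm_add_le _ _).trans (add_le_add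
      (hM _ ⟨Z, i1, i2, i3, i4, i5, i6, i7, i8, φ, h1, h2, h3, rfl⟩)
      (hN _ ⟨Z, i1, i2, i3, i4, i5, i6, i7, i8, φ, h1, h2, h3, rfl⟩))

theorem nuValues_nonneg (w : X ⊗[C] Y) : ∀ r ∈ nuValues C X Y w, 0 ≤ r := by
  rintro r ⟨Z, _, _, _, _, _, _, _, _, φ, -, -, -, rfl⟩
  exact norm_nonneg _

variable (C X Y)

/-- `ν_C(w) = sup ‖φ(w)‖` over all `C`-bilinear contractions `φ` from `X × Y` into normal
representable `C`-bimodules, as a seminorm on the complex vector space `X ⊗_C Y`. -/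
noncomputable def nuSeminorm : Seminorm ℂ (X ⊗[C] Y) :=
  Seminorm.ofSMulLE (fun w => sSup (nuValues C X Y w))
    (le_antisymm
      (Real.sSup_le (by
        rintro r ⟨Z, _, _, _, _, _, _, _, _, φ, -, -, -, rfl⟩
        simp) le_rfl)
      (Real.sSup_nonneg (nuValues_nonneg _)))
    (fun v w => Real.sSup_le (by
        rintro r ⟨Z, i1, i2, i3, i4, i5, i6, i7, i8, φ, h1, h2, h3, rfl⟩
        rw [map_add]
        exact (norm_add_le _ _).trans (add_le_add
          (le_csSup (nuValues_bddAbove v)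
            ⟨Z, i1, i2, i3, i4, i5, i6, i7, i8, φ, h1, h2, h3, rfl⟩)
          (le_csSup (nuValues_bddAbove w)
            ⟨Z, i1, i2, i3, i4, i5, i6, i7, i8, φ, h1, h2, h3, rfl⟩)))
      (add_nonneg (Real.sSup_nonneg (nuValues_nonneg _)) (Real.sSup_nonneg (nuValues_nonneg _))))
    (fun l w => Real.sSup_le (by
        rintro r ⟨Z, i1, i2, i3, i4, i5, i6, i7, i8, φ, h1, h2, h3, rfl⟩
        have h : TensorProduct.lift φ (l • w) = l • TensorProduct.lift φ w := by
          rw [← algebraMap_smul C l w, map_smul, algebraMap_smul]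
        rw [h, norm_smul]
        exact mul_le_mul_of_nonneg_left (le_csSup (nuValues_bddAbove w)
            ⟨Z, i1, i2, i3, i4, i5, i6, i7, i8, φ, h1, h2, h3, rfl⟩) (norm_nonneg _))
      (mul_nonneg (norm_nonneg _) (Real.sSup_nonneg (nuValues_nonneg _))))

theorem nuSeminorm_smul_le (c : C) (w : X ⊗[C] Y) :
    nuSeminorm C X Y (c • w) ≤ ‖c‖ * nuSeminorm C X Y w := by
  refine Real.sSup_le ?_ (mul_nonneg (norm_nonneg _) (apply_nonneg _ _))
  rintro r ⟨Z, i1, i2, i3, i4, i5, i6, i7, i8, φ, h1, h2, h3, rfl⟩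
  have hz : ∀ z : Z, ‖c • z‖ ≤ ‖c‖ * ‖z‖ := by
    obtain ⟨H, _, _, _, K, _, _, _, π, σ, T, -, -, hT⟩ := h1
    intro z
    rw [← T.norm_map (c • z), (hT c z).1, ← T.norm_map z]
    exact (ContinuousLinearMap.opNorm_comp_le _ _).trans
      (mul_le_mul_of_nonneg_right (NonUnitalStarAlgHom.norm_apply_le π c) (norm_nonneg _))
  rw [map_smul]
  exact (hz _).trans (mul_le_mul_of_nonneg_left (le_csSup (nuValues_bddAbove w)
    ⟨Z, i1, i2, i3, i4, i5, i6, i7, i8, φ, h1, h2, h3, rfl⟩) (norm_nonneg _))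

/-- The algebraic tensor product `X ⊗_C Y`, as a `C`-bimodule with `c (x ⊗ y) = (c x) ⊗ y` and
`(x ⊗ y) c = (x c) ⊗ y = x ⊗ (y c)`, to be equipped with `ν_C`. -/
def NuTensor : Type u := X ⊗[C] Y

noncomputable instance : AddCommGroup (NuTensor C X Y) :=
  TensorProduct.addCommGroup (R := C) (M := X) (N := Y)
noncomputable instance : Module ℂ (NuTensor C X Y) :=
  TensorProduct.leftModule (R := C) (R'' := ℂ) (M := X) (N := Y)
noncomputable instance : Module C (NuTensor C X Y) :=
  TensorProduct.leftModule (R := C) (R'' := C) (M := X) (N := Y)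
noncomputable instance : Module Cᵐᵒᵖ (NuTensor C X Y) :=
  TensorProduct.leftModule (R := C) (R'' := Cᵐᵒᵖ) (M := X) (N := Y)
instance : IsScalarTower ℂ C (NuTensor C X Y) := inferInstanceAs (IsScalarTower ℂ C (X ⊗[C] Y))
instance : IsCentralScalar C (NuTensor C X Y) := inferInstanceAs (IsCentralScalar C (X ⊗[C] Y))

/-- `X ⊗_C Y` with the (semi)norm `ν_C`. -/
noncomputable instance : SeminormedAddCommGroup (NuTensor C X Y) :=
  (nuSeminorm C X Y).toAddGroupSeminorm.toSeminormedAddCommGroup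

noncomputable instance : NormedSpace ℂ (NuTensor C X Y) where
  norm_smul_le l w := (map_smul_eq_mul (nuSeminorm C X Y) l w).le

instance : UniformContinuousConstSMul C (NuTensor C X Y) where
  uniformContinuous_const_smul c :=
    (AddMonoidHomClass.lipschitz_of_bound (DistribSMul.toAddMonoidHom (NuTensor C X Y) c) ‖c‖
      (nuSeminorm_smul_le C X Y c)).uniformContinuous

/-- The normal projective tensor product of `X` and `Y` over `C`: the completion of `X ⊗_C Y` with
respect to `ν_C`, with the actions of `C` extended by continuity. -/
abbrev NormalProjTensor : Type u := UniformSpace.Completion (NuTensor C X Y)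

variable {C X Y} in
/-- The canonical image of `x ⊗_C y` in the normal projective tensor product. -/
noncomputable def nuTmul (x : X) (y : Y) : NormalProjTensor C X Y :=
  ((show NuTensor C X Y from x ⊗ₜ[C] y : NuTensor C X Y) : NormalProjTensor C X Y)

variable {C X Y} in
/-- The completion of `X ⊗_C Y` with respect to `p` is a normal representable `C`-bimodule: there is
a normal representable Banach `C`-bimodule `W` with a `C`-bimodule map `j` from `X ⊗_C Y` onto a
dense subspace of `W` such that `‖j(w)‖ = p(w)`. -/
def HasNormalRepresentableCompletion (p : Seminorm ℂ (X ⊗[C] Y)) : Prop :=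
  ∃ (W : Type u) (_ : NormedAddCommGroup W) (_ : NormedSpace ℂ W) (_ : CompleteSpace W)
    (_ : Module C W) (_ : IsScalarTower ℂ C W) (_ : Module Cᵐᵒᵖ W) (_ : IsScalarTower ℂ Cᵐᵒᵖ W)
    (_ : SMulCommClass C Cᵐᵒᵖ W) (j : (X ⊗[C] Y) →ₗ[C] W),
    IsNormalRepresentable C W ∧
    (∀ (c : C) (w : X ⊗[C] Y), j (MulOpposite.op c • w) = MulOpposite.op c • j w) ∧
    (∀ w, ‖j w‖ = p w) ∧ DenseRange j

end Tensor

/-! The formal parts rest on the definition of `ν_C`. A supremum of seminorms coming from normal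
representations is realised isometrically on a Hilbert direct sum, so the completion is
representable. Bilinear maps factor because, after rescaling, they are among the competitors in the
supremum. Any subcross norm with representable completion is dominated because the canonical map
into its completion is also a competitor.

The substance is that `ν_C` is faithful (`eq_zero_of_nuSeminorm_eq_zero`). Let `w = ∑ x_i ⊗ y_i`
with `ν_C(w) = 0`, and represent `X` in `B(K, H)` and `Y` in `B(K', H')`. Each module map `V : H' →
K` gives a bounded bilinear map `T(x) V T'(y)`, so `∑ T(x_i) V T'(y_i) = 0`. Take `V = B A'^*` with
module maps `B`, `A'` from `H₀`, and let `F` be the space of tuples `v` in `H₀ⁿ` with `∑ A^* T(x_i)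
B v_i = 0` for all module maps `A`, `B` from `H₀`. It is invariant under the commutant of `N`, so
its projection is a matrix `q` over `C`. The matrix satisfies `∑_j q_jk x_j = 0` and `y_j = ∑_k q_jk
y_k`, and moving `q` across the tensor sign gives `w = 0`.

This needs module maps from `H₀` to have total range in every normal Hilbert module
(`IsNormalRep.eq_zero_of_forall_intertwines`). A vector orthogonal to all these ranges is singular
to every vector of `H₀`, and normality excludes nonzero singular vectors
(`IsNormalRep.eq_zero_of_singular`). -/

section

open Filter Topology
open scoped InnerProductSpace ComplexOrder

/-! ### Weak limits of bounded monotone nets of operators. -/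

section Vigier

variable {H : Type*} [NormedAddCommGroup H] [InnerProductSpace ℂ H]

theorem ContinuousLinearMap.le_iff_inner_le {S T : H →L[ℂ] H} :
    S ≤ T ↔ ∀ x, ⟪S x, x⟫_ℂ ≤ ⟪T x, x⟫_ℂ := by
  rw [ContinuousLinearMap.le_def, ContinuousLinearMap.isPositive_iff_complex]
  refine forall_congr' fun x => ?_
  rw [← sub_nonneg (b := ⟪S x, x⟫_ℂ), sub_apply, inner_sub_left, Complex.nonneg_iff]
  constructor
  · rintro ⟨h1, h2⟩
    exact ⟨h2, by rw [← h1]; simp⟩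
  · rintro ⟨h1, h2⟩
    exact ⟨by apply Complex.ext <;> simp [← h2], h1⟩

/-- In the order of `ℂ`, comparable numbers have equal imaginary parts. Past any fixed index only
the real part moves, and it is monotone and bounded, so the operators need not be self-adjoint. -/
theorem exists_tendsto_inner_of_monotone {ι : Type*} [Preorder ι] [IsDirectedOrder ι] [Nonempty ι]
    {f : ι → H →L[ℂ] H} (hf : Monotone f) {M : H →L[ℂ] H} (hM : ∀ i, f i ≤ M) (x : H) :
    ∃ l : ℂ, Tendsto (fun i => ⟪f i x, x⟫_ℂ) atTop (𝓝 l) := by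
  obtain ⟨i₀⟩ := ‹Nonempty ι›
  have key : ∀ i, i₀ ≤ i → ⟪f i x, x⟫_ℂ = (⟪f i x, x⟫_ℂ).re + (⟪f i₀ x, x⟫_ℂ).im * Complex.I := by
    intro i hi
    have h := Complex.le_def.1 (ContinuousLinearMap.le_iff_inner_le.1 (hf hi) x)
    apply Complex.ext <;> simp [h.2]
  have hmono : Monotone fun i => (⟪f i x, x⟫_ℂ).re := fun i j hij =>
    (Complex.le_def.1 (ContinuousLinearMap.le_iff_inner_le.1 (hf hij) x)).1
  have hbdd : BddAbove (Set.range fun i => (⟪f i x, x⟫_ℂ).re) := by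
    refine ⟨(⟪M x, x⟫_ℂ).re, ?_⟩
    rintro _ ⟨i, rfl⟩
    exact (Complex.le_def.1 (ContinuousLinearMap.le_iff_inner_le.1 (hM i) x)).1
  have h1 := tendsto_atTop_ciSup hmono hbdd
  refine ⟨((⨆ i, (⟪f i x, x⟫_ℂ).re : ℝ) : ℂ) + (⟪f i₀ x, x⟫_ℂ).im * Complex.I, ?_⟩
  refine Tendsto.congr' ?_ (((Complex.continuous_ofReal.tendsto _).comp h1).add_const _)
  filter_upwards [eventually_ge_atTop i₀] with i hi
  exact (key i hi).symm

theorem exists_tendsto_inner_of_monotone' {ι : Type*} [Preorder ι] [IsDirectedOrder ι] [Nonempty ι]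
    {f : ι → H →L[ℂ] H} (hf : Monotone f) {M : H →L[ℂ] H} (hM : ∀ i, f i ≤ M) (x y : H) :
    ∃ l : ℂ, Tendsto (fun i => ⟪f i x, y⟫_ℂ) atTop (𝓝 l) := by
  obtain ⟨a, ha⟩ := exists_tendsto_inner_of_monotone hf hM (y + x)
  obtain ⟨b, hb⟩ := exists_tendsto_inner_of_monotone hf hM (y - x)
  obtain ⟨c, hc⟩ := exists_tendsto_inner_of_monotone hf hM (y + Complex.I • x)
  obtain ⟨d, hd⟩ := exists_tendsto_inner_of_monotone hf hM (y - Complex.I • x)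
  refine ⟨_, Tendsto.congr (fun i => ?_)
    ((((ha.sub hb).add (hc.const_mul Complex.I)).sub (hd.const_mul Complex.I)).div_const 4)⟩
  have := inner_map_polarization (f i : H →ₗ[ℂ] H) y x
  simp only [ContinuousLinearMap.coe_coe] at this
  rw [this]

variable [CompleteSpace H]

/-- A bounded monotone net of operators converges weakly to its supremum. -/
theorem exists_isLUB_tendsto_inner {ι : Type*} [Preorder ι] [IsDirectedOrder ι] [Nonempty ι]
    {f : ι → H →L[ℂ] H} (hf : Monotone f) {M : H →L[ℂ] H} (hM : ∀ i, f i ≤ M) :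
    ∃ S : H →L[ℂ] H, IsLUB (Set.range f) S ∧
      ∀ x y, Tendsto (fun i => ⟪f i x, y⟫_ℂ) atTop (𝓝 ⟪S x, y⟫_ℂ) := by
  choose B hB using exists_tendsto_inner_of_monotone' hf hM
  obtain ⟨i₀⟩ := ‹Nonempty ι›
  -- The net need not be bounded below, so norms are controlled only on the tail, where `0 ≤ f i - f
  -- i₀ ≤ M - f i₀`.
  have hbd : ∀ i, i₀ ≤ i → ‖f i‖ ≤ ‖M - f i₀‖ + ‖f i₀‖ := by
    intro i hi
    calc ‖f i‖ = ‖(f i - f i₀) + f i₀‖ := by rw [sub_add_cancel]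
      _ ≤ ‖f i - f i₀‖ + ‖f i₀‖ := norm_add_le _ _
      _ ≤ _ := by
        gcongr 1
        exact CStarAlgebra.norm_le_norm_of_nonneg_of_le (sub_nonneg.2 (hf hi))
          (sub_le_sub_right (hM i) _)
  have hnB : ∀ x y, ‖B x y‖ ≤ (‖M - f i₀‖ + ‖f i₀‖) * ‖x‖ * ‖y‖ := by
    intro x y
    refine le_of_tendsto (hB x y).norm ?_
    filter_upwards [eventually_ge_atTop i₀] with i hi
    refine (norm_inner_le_norm _ _).trans ?_
    gcongr
    exact (f i).le_of_opNorm_le (hbd i hi) x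
  let B' : H →ₗ⋆[ℂ] H →ₗ[ℂ] ℂ := LinearMap.mk₂'ₛₗ _ _ B
    (fun x x' y => tendsto_nhds_unique (hB _ _) (((hB x y).add (hB x' y)).congr fun i => by
      rw [map_add, inner_add_left]))
    (fun c x y => tendsto_nhds_unique (hB _ _) (((hB x y).const_mul (starRingEnd ℂ c)).congr
      fun i => by rw [map_smul, inner_smul_left]))
    (fun x y y' => tendsto_nhds_unique (hB _ _) (((hB x y).add (hB x y')).congr fun i => by
      rw [inner_add_right]))
    (fun c x y => tendsto_nhds_unique (hB _ _) (((hB x y).const_mul c).congr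
      fun i => by rw [inner_smul_right]))
  let S := InnerProductSpace.continuousLinearMapOfBilin (𝕜 := ℂ) (B'.mkContinuous₂ _ hnB)
  have hS : ∀ x y, ⟪S x, y⟫_ℂ = B x y := fun x y =>
    InnerProductSpace.continuousLinearMapOfBilin_apply _ x y
  refine ⟨S, ⟨?_, ?_⟩, fun x y => by rw [hS]; exact hB x y⟩
  · rintro _ ⟨i, rfl⟩
    rw [ContinuousLinearMap.le_iff_inner_le]
    intro x
    rw [hS]
    refine ge_of_tendsto (hB x x) ?_
    filter_upwards [eventually_ge_atTop i] with j hj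
    exact ContinuousLinearMap.le_iff_inner_le.1 (hf hj) x
  · intro U hU
    rw [ContinuousLinearMap.le_iff_inner_le]
    intro x
    rw [hS]
    have : Nonempty ι := ⟨i₀⟩
    exact le_of_tendsto (hB x x) (Eventually.of_forall fun i =>
      ContinuousLinearMap.le_iff_inner_le.1 (hU ⟨i, rfl⟩) x)

end Vigier

/-! ### Normality as weak operator convergence. -/

section NormalRep

variable {C : Type u} [CommCStarAlgebra C] [PartialOrder C] [StarOrderedRing C]

/-- The weak limit of the increasing net `π '' D` is its supremum, and normality identifies that
supremum with `π a`. -/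
theorem IsNormalRep.tendsto_inner {H : Type u} [NormedAddCommGroup H] [InnerProductSpace ℂ H]
    [CompleteSpace H] {π : C →⋆ₐ[ℂ] (H →L[ℂ] H)} (hπ : IsNormalRep π)
    {D : Set C} {a : C} (hsa : ∀ d ∈ D, IsSelfAdjoint d) (hne : D.Nonempty)
    (hdir : DirectedOn (· ≤ ·) D) (ha : IsLUB D a) (x y : H) :
    Tendsto (fun d : D => ⟪π d x, y⟫_ℂ) atTop (𝓝 ⟪π a x, y⟫_ℂ) := by
  have : Nonempty D := hne.to_subtype
  have : IsDirectedOrder D := ⟨hdir.directed_val⟩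
  have hm : Monotone fun d : D => π d := fun d d' h => OrderHomClass.mono π h
  obtain ⟨S, hS, hS'⟩ := exists_isLUB_tendsto_inner hm
    (M := π a) (fun d => OrderHomClass.mono π (ha.1 d.2))
  have h := hπ D a hsa hne hdir ha
  rw [Set.image_eq_range] at h
  rw [h.unique hS]
  exact hS' x y

/-- Normality can be tested on the matrix coefficients of a set of vectors that determines the
bounded operators. -/
theorem isNormalRep_of_tendsto_inner {H : Type u} [NormedAddCommGroup H] [InnerProductSpace ℂ H]
    [CompleteSpace H] {π : C →⋆ₐ[ℂ] (H →L[ℂ] H)} {V : Set H}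
    (hext : ∀ S T : H →L[ℂ] H, (∀ x ∈ V, ∀ y ∈ V, ⟪S x, y⟫_ℂ = ⟪T x, y⟫_ℂ) → S = T)
    (h : ∀ (D : Set C) (a : C), (∀ d ∈ D, IsSelfAdjoint d) → D.Nonempty → DirectedOn (· ≤ ·) D →
      IsLUB D a → ∀ x ∈ V, ∀ y ∈ V,
        Tendsto (fun d : D => ⟪π d x, y⟫_ℂ) atTop (𝓝 ⟪π a x, y⟫_ℂ)) :
    IsNormalRep π := by
  intro D a hsa hne hdir ha
  have : Nonempty D := hne.to_subtype
  have : IsDirectedOrder D := ⟨hdir.directed_val⟩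
  have hm : Monotone fun d : D => π d := fun d d' h => OrderHomClass.mono π h
  obtain ⟨S, hS, hS'⟩ := exists_isLUB_tendsto_inner hm
    (M := π a) (fun d => OrderHomClass.mono π (ha.1 d.2))
  have : S = π a := hext _ _ fun x hx y hy =>
    tendsto_nhds_unique (hS' x y) (h D a hsa hne hdir ha x hx y hy)
  rw [Set.image_eq_range, ← this]
  exact hS

end NormalRep

/-! ### Order structure of the von Neumann algebra. -/

section VonNeumann

variable {C : Type u} [CommCStarAlgebra C]
variable {H₀ : Type u} [NormedAddCommGroup H₀] [InnerProductSpace ℂ H₀] [CompleteSpace H₀]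

/-- The representation of `C` on `H₀` given by an identification with a von Neumann algebra. -/
noncomputable def vnRep (N : VonNeumannAlgebra H₀) (e : C ≃⋆ₐ[ℂ] N.toStarSubalgebra) :
    C →⋆ₐ[ℂ] (H₀ →L[ℂ] H₀) :=
  N.toStarSubalgebra.subtype.comp (e : C →⋆ₐ[ℂ] N.toStarSubalgebra)

variable (N : VonNeumannAlgebra H₀) (e : C ≃⋆ₐ[ℂ] N.toStarSubalgebra)

theorem vnRep_injective : Function.Injective (vnRep N e) := fun _ _ h =>
  e.injective (Subtype.ext h)

variable {N} in
theorem exists_vnRep_eq {S : H₀ →L[ℂ] H₀} (hS : S ∈ N) : ∃ c, vnRep N e c = S :=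
  ⟨e.symm ⟨S, hS⟩, by simp [vnRep]⟩

theorem vnRep_mem (c : C) : vnRep N e c ∈ N := (e c).2

variable [PartialOrder C] [StarOrderedRing C]

/-- With `c = b - a`, one has `c⁻ c c⁻ = -(c⁻)³`. The image of this element is both nonnegative and
nonpositive, so injectivity gives `(c⁻)³ = 0`, and the C*-identity gives `c⁻ = 0`. -/
theorem StarAlgHom.le_of_map_le {B : Type*} [CStarAlgebra B] [PartialOrder B] [StarOrderedRing B]
    {φ : C →⋆ₐ[ℂ] B} (hφ : Function.Injective φ) {a b : C}
    (h : φ a ≤ φ b) (hab : IsSelfAdjoint (b - a)) : a ≤ b := by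
  rw [← sub_nonneg] at h ⊢
  rw [← map_sub] at h
  set c := b - a
  have h1 : c * c⁻ = - (c⁻ * c⁻) := by
    nth_rw 1 [← CFC.posPart_sub_negPart c hab]
    rw [sub_mul, CFC.posPart_mul_negPart, zero_sub]
  have hn : (0 : C) ≤ c⁻ := CFC.negPart_nonneg c
  have hsn : star c⁻ = c⁻ := hn.isSelfAdjoint
  have h2 : 0 ≤ φ (c⁻ * c * c⁻) := by
    have := star_right_conjugate_nonneg h (φ c⁻)
    rwa [← map_star, hsn, ← map_mul, ← map_mul] at this
  have h3 : φ (c⁻ * c * c⁻) = - φ (c⁻ * c⁻ * c⁻) := by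
    rw [mul_assoc, h1, mul_neg, map_neg, mul_assoc]
  have h4 : 0 ≤ φ (c⁻ * c⁻ * c⁻) := by
    refine map_nonneg φ ?_
    have := star_right_conjugate_nonneg hn c⁻
    rwa [hsn] at this
  have h5 : c⁻ * c⁻ * c⁻ = 0 := by
    apply hφ
    rw [map_zero]
    exact le_antisymm (by rw [h3] at h2; exact neg_nonneg.1 h2) h4
  have h6 : c⁻ = 0 := by
    have h7 : c⁻ * c⁻ = 0 := by
      have : star (c⁻ * c⁻) * (c⁻ * c⁻) = 0 := by
        rw [star_mul, hsn, ← mul_assoc, h5, zero_mul]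
      exact (CStarRing.star_mul_self_eq_zero_iff _).1 this
    have : star c⁻ * c⁻ = 0 := by rw [hsn, h7]
    exact (CStarRing.star_mul_self_eq_zero_iff _).1 this
  rw [← CFC.posPart_sub_negPart c hab, h6, sub_zero]
  exact CFC.posPart_nonneg c

/-- Monotone completeness of a von Neumann algebra. -/
theorem exists_isLUB_tendsto_vnRep {D : Set C} (hsa : ∀ d ∈ D, IsSelfAdjoint d) (hne : D.Nonempty)
    (hdir : DirectedOn (· ≤ ·) D) (hbdd : BddAbove D) :
    ∃ a, IsLUB D a ∧ IsSelfAdjoint a ∧ ∀ x y,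
      Tendsto (fun d : D => ⟪vnRep N e d x, y⟫_ℂ) atTop (𝓝 ⟪vnRep N e a x, y⟫_ℂ) := by
  have : Nonempty D := hne.to_subtype
  have : IsDirectedOrder D := ⟨hdir.directed_val⟩
  have hm : Monotone fun d : D => vnRep N e d := fun d d' h => OrderHomClass.mono (vnRep N e) h
  obtain ⟨b, hb⟩ := hbdd
  obtain ⟨S, hS, hS'⟩ := exists_isLUB_tendsto_inner hm
    (M := vnRep N e b) (fun d => OrderHomClass.mono (vnRep N e) (hb d.2))
  -- Commutation with an element of the commutant passes to weak limits, so `S` lies in the double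
  -- commutant.
  have hSN : S ∈ N := by
    rw [← VonNeumannAlgebra.commutant_commutant N, VonNeumannAlgebra.mem_commutant_iff]
    intro t ht
    rw [VonNeumannAlgebra.mem_commutant_iff] at ht
    ext x
    refine ext_inner_right ℂ fun y => ?_
    refine tendsto_nhds_unique ?_ (hS' (t x) y)
    refine (hS' x (ContinuousLinearMap.adjoint t y)).congr' ?_ |>.trans_eq ?_
    · refine Eventually.of_forall fun d => ?_
      beta_reduce
      rw [ContinuousLinearMap.adjoint_inner_right, ← mul_apply_eq_comp,
        ← mul_apply_eq_comp, ht _ (vnRep_mem N e d)]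
    · rw [ContinuousLinearMap.adjoint_inner_right]; rfl
  obtain ⟨a, rfl⟩ := exists_vnRep_eq e hSN
  obtain ⟨d₀, hd₀⟩ := hne
  have hrefl : ∀ {c c' : C}, vnRep N e c ≤ vnRep N e c' → c ≤ c' := by
    intro c c' h
    refine StarAlgHom.le_of_map_le (vnRep_injective N e) h ?_
    have : IsSelfAdjoint (vnRep N e (c' - c)) := by
      rw [map_sub]
      exact (sub_nonneg.2 h).isSelfAdjoint
    apply vnRep_injective N e
    rw [map_star, this.star_eq]
  have hub : a ∈ upperBounds D := fun d hd => hrefl (hS.1 ⟨⟨d, hd⟩, rfl⟩)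
  refine ⟨a, ⟨hub, fun u hu => hrefl (hS.2 ?_)⟩, ?_, hS'⟩
  · rintro _ ⟨d, rfl⟩
    exact OrderHomClass.mono (vnRep N e) (hu d.2)
  · rw [← sub_add_cancel a d₀]
    exact (sub_nonneg.2 (hub hd₀)).isSelfAdjoint.add (hsa _ hd₀)

end VonNeumann

/-! ### Effects and vector functionals. -/

section Functional

variable {C : Type*} [CommCStarAlgebra C] [PartialOrder C] [StarOrderedRing C]

/-- Truncation of the modulus of an element at the level `1`. -/
theorem exists_truncation (c : C) : ∃ b : C, 0 ≤ b ∧ b ≤ 1 ∧ star b * b ≤ star c * c ∧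
    star (1 - b) * (1 - b) ≤ star (1 - c) * (1 - c) := by
  have hc : IsStarNormal c := inferInstance
  -- This truncation satisfies both `|f z| ≤ |z|` and `|1 - f z| ≤ |1 - z|`, so being small at one
  -- vector and close to `1` at another both survive.
  let f : ℂ → ℂ := fun z => ((min ‖z‖ 1 : ℝ) : ℂ)
  have hf : Continuous f := by fun_prop
  have hb0 : 0 ≤ cfc f c := by
    rw [cfc_nonneg_iff f c hf.continuousOn]
    intro z _
    exact Complex.zero_le_real.2 (le_min (norm_nonneg _) zero_le_one)
  have hconj : ∀ z : ℂ, star z * z = ((‖z‖ ^ 2 : ℝ) : ℂ) := fun z => by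
    rw [Complex.star_def, mul_comm, Complex.mul_conj, Complex.normSq_eq_norm_sq]
  refine ⟨cfc f c, hb0, ?_, ?_, ?_⟩
  · conv_rhs => rw [← cfc_one ℂ c]
    refine cfc_mono fun z _ => ?_
    exact Complex.real_le_real.2 (min_le_right _ _) |>.trans_eq (by simp)
  · have h1 : star c * c = cfc (fun z : ℂ => star z * z) c := by
      rw [cfc_mul (fun z : ℂ => star z) (fun z => z) c, cfc_star_id, cfc_id' ℂ c]
    rw [h1, ← cfc_star, ← cfc_mul _ _ c]
    refine cfc_mono fun z _ => ?_
    rw [hconj, hconj]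
    refine Complex.real_le_real.2 ?_
    simp only [f, Complex.norm_real, Real.norm_eq_abs, sq_abs]
    gcongr
    exact min_le_left _ _
  · have h2 : 1 - c = cfc (fun z : ℂ => 1 - z) c := by
      rw [cfc_sub (fun _ : ℂ => (1 : ℂ)) (fun z => z) c, cfc_const_one ℂ c, cfc_id' ℂ c]
    have h3 : 1 - cfc f c = cfc (fun z : ℂ => 1 - f z) c := by
      rw [cfc_sub (fun _ : ℂ => (1 : ℂ)) f c, cfc_const_one ℂ c]
    rw [h2, h3, ← cfc_star, ← cfc_star, ← cfc_mul _ _ c, ← cfc_mul _ _ c]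
    refine cfc_mono fun z _ => ?_
    rw [hconj, hconj]
    refine Complex.real_le_real.2 ?_
    have h4 : ‖1 - f z‖ = 1 - min ‖z‖ 1 := by
      have : (1 : ℂ) - f z = ((1 - min ‖z‖ 1 : ℝ) : ℂ) := by simp [f]
      rw [this, Complex.norm_real, Real.norm_eq_abs, abs_of_nonneg (sub_nonneg.2 (min_le_right _ _))]
    rw [h4]
    have h5 : 0 ≤ 1 - min ‖z‖ 1 := sub_nonneg.2 (min_le_right _ _)
    refine pow_le_pow_left₀ h5 ?_ 2
    have h6 : 1 - ‖z‖ ≤ ‖1 - z‖ := by simpa using norm_sub_norm_le (1 : ℂ) z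
    rcases le_total ‖z‖ 1 with h | h
    · rwa [min_eq_left h]
    · rw [min_eq_right h]; simp

variable {H : Type*} [NormedAddCommGroup H] [InnerProductSpace ℂ H] [CompleteSpace H]

/-- The real part of the functional `c ↦ ⟪π c x, x⟫`. -/
noncomputable def vectorFunctional (π : C →⋆ₐ[ℂ] (H →L[ℂ] H)) (x : H) : C →+ ℝ where
  toFun c := (⟪π c x, x⟫_ℂ).re
  map_zero' := by simp
  map_add' c d := by simp

variable (π : C →⋆ₐ[ℂ] (H →L[ℂ] H)) (x : H)

theorem vectorFunctional_apply (c : C) : vectorFunctional π x c = (⟪π c x, x⟫_ℂ).re := rfl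

theorem vectorFunctional_mono : Monotone (vectorFunctional π x) := fun _ _ h =>
  (Complex.le_def.1 (ContinuousLinearMap.le_iff_inner_le.1 (OrderHomClass.mono π h) x)).1

theorem vectorFunctional_star_mul_self (c : C) :
    vectorFunctional π x (star c * c) = ‖π c x‖ ^ 2 := by
  rw [vectorFunctional_apply, map_mul, map_star, ContinuousLinearMap.star_eq_adjoint,
    mul_apply_eq_comp, ContinuousLinearMap.adjoint_inner_left, inner_self_eq_norm_sq_to_K]
  norm_cast

theorem vectorFunctional_le (c : C) : vectorFunctional π x c ≤ ‖π c x‖ * ‖x‖ :=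
  (Complex.re_le_norm _).trans (norm_inner_le_norm _ _)

theorem norm_apply_le_of_star_mul_self_le {b c : C} (h : star b * b ≤ star c * c) :
    ‖π b x‖ ≤ ‖π c x‖ := by
  have := vectorFunctional_mono π x h
  rw [vectorFunctional_star_mul_self, vectorFunctional_star_mul_self] at this
  exact le_of_sq_le_sq this (norm_nonneg _)

theorem mul_le_left_of_nonneg_of_le_one {a b : C} (ha : 0 ≤ a) (hb : b ≤ 1) : a * b ≤ a := by
  rw [← sub_nonneg]
  have := Commute.mul_nonneg ha (sub_nonneg.2 hb) (Commute.all _ _)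
  rwa [mul_sub, mul_one] at this

/-- For an effect `c² ≤ c`, hence `‖π c x‖²` is at most the value of the functional at `c`. -/
theorem apply_eq_zero_of_vectorFunctional_le_zero {c : C} (h0 : 0 ≤ c) (h1 : c ≤ 1)
    (h : vectorFunctional π x c ≤ 0) : π c x = 0 := by
  have h2 : star c * c ≤ c := by
    rw [h0.isSelfAdjoint.star_eq]
    exact mul_le_left_of_nonneg_of_le_one h0 h1
  have h3 := (vectorFunctional_mono π x h2).trans h
  rw [vectorFunctional_star_mul_self] at h3
  simpa using le_antisymm h3 (sq_nonneg _)

/-- A union bound for commuting effects: `(1 - p) + (1 - q) - (1 - pq) = (1 - p)(1 - q) ≥ 0`. -/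
theorem prod_effects {b : ℕ → C} (h0 : ∀ n, 0 ≤ b n) (h1 : ∀ n, b n ≤ 1) (n : ℕ) :
    0 ≤ ∏ k ∈ Finset.range n, b k ∧ ∏ k ∈ Finset.range n, b k ≤ 1 ∧
      1 - ∏ k ∈ Finset.range n, b k ≤ ∑ k ∈ Finset.range n, (1 - b k) := by
  induction n with
  | zero => simp
  | succ n ih =>
    obtain ⟨i0, i1, i2⟩ := ih
    rw [Finset.prod_range_succ, Finset.sum_range_succ]
    set p := ∏ k ∈ Finset.range n, b k
    refine ⟨Commute.mul_nonneg i0 (h0 n) (Commute.all _ _),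
      (mul_le_left_of_nonneg_of_le_one i0 (h1 n)).trans i1, ?_⟩
    refine le_trans ?_ (add_le_add_left i2 _)
    rw [← sub_nonneg]
    have := Commute.mul_nonneg (sub_nonneg.2 i1) (sub_nonneg.2 (h1 n)) (Commute.all _ _)
    convert this using 1
    ring

end Functional

/-! ### Normality excludes nonzero singular vectors. -/

section Singular

variable {C : Type u} [CommCStarAlgebra C] [PartialOrder C] [StarOrderedRing C]
variable {H₀ : Type u} [NormedAddCommGroup H₀] [InnerProductSpace ℂ H₀] [CompleteSpace H₀]
variable (N : VonNeumannAlgebra H₀) (e : C ≃⋆ₐ[ℂ] N.toStarSubalgebra)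
variable {H : Type u} [NormedAddCommGroup H] [InnerProductSpace ℂ H] [CompleteSpace H]
  (π : C →⋆ₐ[ℂ] (H →L[ℂ] H))

/-- If effects are simultaneously close to `1` at `z` and to `0` at `x`, then some of them vanish
at `x`. -/
theorem exists_effect_apply_eq_zero {z : H₀} {x : H}
    (h : ∀ ε > 0, ∃ b : C, 0 ≤ b ∧ b ≤ 1 ∧ vectorFunctional (vnRep N e) z (1 - b) ≤ ε ∧
      vectorFunctional π x b ≤ ε) {ε : ℝ} (hε : 0 < ε) :
    ∃ d : C, 0 ≤ d ∧ d ≤ 1 ∧ vectorFunctional (vnRep N e) z (1 - d) ≤ ε ∧ π d x = 0 := by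
  -- These tolerances sum to `ε`, which bounds the loss at `z`, and tend to `0`, which makes the
  -- infimum of the partial products vanish at `x`.
  choose b hb0 hb1 hbz hbx using fun n : ℕ => h (ε / 2 / 2 ^ n) (by positivity)
  let p : ℕ → C := fun n => ∏ k ∈ Finset.range n, b k
  have hp := prod_effects hb0 hb1
  have hpanti : Antitone p := antitone_nat_of_succ_le fun n => by
    simp only [p, Finset.prod_range_succ]
    exact mul_le_left_of_nonneg_of_le_one (hp n).1 (hb1 n)
  let D : Set C := Set.range fun n => 1 - p n
  have hmono : Monotone fun n => 1 - p n := fun i j hij => sub_le_sub_left (hpanti hij) _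
  obtain ⟨a, ha, -, hta⟩ := exists_isLUB_tendsto_vnRep N e (D := D)
    (by rintro _ ⟨n, rfl⟩; exact (sub_nonneg.2 (hp n).2.1).isSelfAdjoint)
    (Set.range_nonempty _) (hmono.directed_le.directedOn_range)
    ⟨1, by rintro _ ⟨n, rfl⟩; exact sub_le_self _ (hp n).1⟩
  have ha1 : a ≤ 1 := ha.2 (by rintro _ ⟨n, rfl⟩; exact sub_le_self _ (hp n).1)
  have ha0 : 0 ≤ a := (sub_nonneg.2 (hp 0).2.1).trans (ha.1 ⟨0, rfl⟩)
  have hle : ∀ n, 1 - a ≤ p n := fun n => by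
    have := ha.1 ⟨n, rfl⟩
    exact sub_le_comm.1 this
  refine ⟨1 - a, sub_nonneg.2 ha1, sub_le_self _ ha0, ?_, ?_⟩
  · rw [sub_sub_cancel]
    have : Nonempty D := (Set.range_nonempty _).to_subtype
    have : IsDirectedOrder D := ⟨(hmono.directed_le.directedOn_range).directed_val⟩
    refine le_of_tendsto ((Complex.continuous_re.tendsto _).comp (hta z z))
      (Eventually.of_forall ?_)
    rintro ⟨_, n, rfl⟩
    change vectorFunctional (vnRep N e) z (1 - p n) ≤ ε
    refine (vectorFunctional_mono _ z (hp n).2.2).trans ?_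
    rw [map_sum]
    calc ∑ k ∈ Finset.range n, vectorFunctional (vnRep N e) z (1 - b k)
        ≤ ∑ k ∈ Finset.range n, ε / 2 / 2 ^ k := Finset.sum_le_sum fun k _ => hbz k
      _ ≤ ∑' k, ε / 2 / 2 ^ k :=
        (summable_geometric_two' ε).sum_le_tsum _ fun k _ => by positivity
      _ = ε := tsum_geometric_two' ε
  · refine apply_eq_zero_of_vectorFunctional_le_zero π x (sub_nonneg.2 ha1) (sub_le_self _ ha0) ?_
    have hlim : Tendsto (fun n : ℕ => ε / 2 / 2 ^ n) atTop (𝓝 0) :=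
      (summable_geometric_two' ε).tendsto_atTop_zero
    refine ge_of_tendsto' hlim fun n => ?_
    refine (vectorFunctional_mono π x ?_).trans (hbx n)
    -- The product of length `n + 1` is the first to contain the factor `b n`, so `1 - a ≤ p (n + 1)
    -- ≤ b n`.
    refine (hle (n + 1)).trans ?_
    simp only [p, Finset.prod_range_succ]
    rw [mul_comm]
    exact mul_le_left_of_nonneg_of_le_one (hb0 n) (hp n).2.1

variable {π}

/-- A vector of a normal representation that is singular to all vectors of `H₀` is zero. -/
theorem IsNormalRep.eq_zero_of_singular (hπ : IsNormalRep π) {x : H}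
    (h : ∀ z : H₀, ∀ ε > 0, ∃ c : C, ‖vnRep N e c z - z‖ ≤ ε ∧ ‖π c x‖ ≤ ε) : x = 0 := by
  have h1 : ∀ z : H₀, ∀ ε > 0, ∃ b : C, 0 ≤ b ∧ b ≤ 1 ∧
      vectorFunctional (vnRep N e) z (1 - b) ≤ ε ∧ vectorFunctional π x b ≤ ε := by
    intro z ε hε
    -- `vectorFunctional_le` costs a factor `‖z‖` or `‖x‖`; this denominator absorbs both and is
    -- never zero.
    obtain ⟨c, hc1, hc2⟩ := h z (ε / (‖z‖ + ‖x‖ + 1)) (by positivity)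
    obtain ⟨b, hb0, hb1, hbc, hbc'⟩ := exists_truncation c
    have hk : ∀ t : ℝ, 0 ≤ t → t ≤ ‖z‖ + ‖x‖ + 1 → ε / (‖z‖ + ‖x‖ + 1) * t ≤ ε := by
      intro t ht0 ht
      rw [div_mul_eq_mul_div, div_le_iff₀ (by positivity)]
      gcongr
    refine ⟨b, hb0, hb1, ?_, ?_⟩
    · refine (vectorFunctional_le _ _ _).trans (le_trans ?_ (hk ‖z‖ (norm_nonneg _)
        (by linarith [norm_nonneg x])))
      gcongr
      refine (norm_apply_le_of_star_mul_self_le _ _ hbc').trans ?_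
      rwa [map_sub, map_one, sub_apply, one_apply_eq_self, norm_sub_rev]
    · refine (vectorFunctional_le _ _ _).trans (le_trans ?_ (hk ‖x‖ (norm_nonneg _)
        (by linarith [norm_nonneg z])))
      gcongr
      exact (norm_apply_le_of_star_mul_self_le _ _ hbc).trans hc2
  -- By normality the supremum of the effects that kill `x` kills `x` too. It remains to see that
  -- this supremum is `1`.
  let D : Set C := {c | 0 ≤ c ∧ c ≤ 1 ∧ π c x = 0}
  have hsa : ∀ d ∈ D, IsSelfAdjoint d := fun d hd => hd.1.isSelfAdjoint
  have hne : D.Nonempty := ⟨0, le_rfl, zero_le_one, by simp⟩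
  have hdir : DirectedOn (· ≤ ·) D := by
    rintro c ⟨hc0, hc1, hc⟩ d ⟨hd0, hd1, hd⟩
    -- The upper bound is `1 - (1 - c)(1 - d)`.
    refine ⟨c + d - c * d, ⟨?_, ?_, ?_⟩, ?_, ?_⟩
    · rw [add_sub_assoc]
      refine add_nonneg hc0 (sub_nonneg.2 ?_)
      rw [mul_comm]
      exact mul_le_left_of_nonneg_of_le_one hd0 hc1
    · rw [← sub_nonneg]
      have := Commute.mul_nonneg (sub_nonneg.2 hc1) (sub_nonneg.2 hd1) (Commute.all _ _)
      convert this using 1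
      ring
    · simp [hc, hd]
    · rw [add_sub_assoc]
      refine le_add_of_nonneg_right (sub_nonneg.2 ?_)
      rw [mul_comm]
      exact mul_le_left_of_nonneg_of_le_one hd0 hc1
    · rw [add_comm, add_sub_assoc]
      exact le_add_of_nonneg_right (sub_nonneg.2 (mul_le_left_of_nonneg_of_le_one hc0 hd1))
  obtain ⟨a, ha, -, -⟩ := exists_isLUB_tendsto_vnRep N e hsa hne hdir ⟨1, fun d hd => hd.2.1⟩
  have ha1 : a ≤ 1 := ha.2 fun d hd => hd.2.1
  have hax : π a x = 0 := by
    refine ext_inner_right ℂ fun y => ?_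
    have : Nonempty D := hne.to_subtype
    have : IsDirectedOrder D := ⟨hdir.directed_val⟩
    refine tendsto_nhds_unique (hπ.tendsto_inner hsa hne hdir ha x y) ?_
    refine tendsto_const_nhds.congr fun d => ?_
    rw [d.2.2.2]
  have haz : a = 1 := by
    symm
    rw [← sub_eq_zero]
    apply vnRep_injective N e
    rw [map_zero]
    ext z
    refine apply_eq_zero_of_vectorFunctional_le_zero _ z (sub_nonneg.2 ha1)
      (sub_le_self _ (ha.1 hne.some_mem |>.trans' hne.some_mem.1)) ?_
    refine le_of_forall_pos_le_add fun ε hε => ?_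
    obtain ⟨d, hd0, hd1, hdz, hdx⟩ := exists_effect_apply_eq_zero N e π (h1 z) hε
    rw [zero_add]
    exact (vectorFunctional_mono _ z (sub_le_sub_left (ha.1 ⟨hd0, hd1, hdx⟩) _)).trans hdz
  simpa [haz] using hax

end Singular

/-! ### Projections onto invariant subspaces. -/

section Commute

variable {E : Type*} [NormedAddCommGroup E] [InnerProductSpace ℂ E]

/-- Since the formal adjoint `T'` preserves `U`, the map `T` preserves `Uᗮ` as well. Plain functions
suffice, so coordinatewise actions need not be bundled as operators. -/
theorem Submodule.starProjection_apply_of_invariant (U : Submodule ℂ E) [U.HasOrthogonalProjection]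
    {T T' : E → E} (hT : ∀ x ∈ U, T x ∈ U) (hT' : ∀ x ∈ U, T' x ∈ U)
    (hsub : ∀ x y, T (x - y) = T x - T y)
    (hadj : ∀ x y, ⟪T x, y⟫_ℂ = ⟪x, T' y⟫_ℂ) (x : E) :
    U.starProjection (T x) = T (U.starProjection x) := by
  refine U.eq_starProjection_of_mem_orthogonal (hT _ (U.starProjection_apply_mem x)) ?_
  rw [← hsub, Submodule.mem_orthogonal']
  intro y hy
  rw [hadj]
  exact (Submodule.mem_orthogonal' _ _).1 (U.sub_starProjection_mem_orthogonal x) _ (hT' y hy)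

end Commute

/-! ### Module maps between Hilbert modules. -/

section Intertwiner

variable {C : Type*} [CommCStarAlgebra C]
variable {H K : Type*} [NormedAddCommGroup H] [InnerProductSpace ℂ H] [CompleteSpace H]
  [NormedAddCommGroup K] [InnerProductSpace ℂ K] [CompleteSpace K]

theorem StarAlgHom.inner_apply_left (π : C →⋆ₐ[ℂ] (H →L[ℂ] H)) (c : C) (x y : H) :
    ⟪π c x, y⟫_ℂ = ⟪x, π (star c) y⟫_ℂ := by
  rw [map_star, ContinuousLinearMap.star_eq_adjoint, ContinuousLinearMap.adjoint_inner_right]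

/-- `A` is a `C`-module map from the Hilbert module `(H, π)` to the Hilbert module `(K, σ)`. -/
def Intertwines (π : C →⋆ₐ[ℂ] (H →L[ℂ] H)) (σ : C →⋆ₐ[ℂ] (K →L[ℂ] K)) (A : H →L[ℂ] K) : Prop :=
  ∀ c x, A (π c x) = σ c (A x)

theorem Intertwines.adjoint {π : C →⋆ₐ[ℂ] (H →L[ℂ] H)} {σ : C →⋆ₐ[ℂ] (K →L[ℂ] K)} {A : H →L[ℂ] K}
    (hA : Intertwines π σ A) : Intertwines σ π (ContinuousLinearMap.adjoint A) := by
  intro c y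
  refine ext_inner_right ℂ fun x => ?_
  rw [ContinuousLinearMap.adjoint_inner_left, StarAlgHom.inner_apply_left,
    StarAlgHom.inner_apply_left, ContinuousLinearMap.adjoint_inner_left, hA]

end Intertwiner

/-! ### The standard module `H₀` generates all normal Hilbert modules. -/

section Generator

variable {C : Type u} [CommCStarAlgebra C] [PartialOrder C] [StarOrderedRing C]
variable {H₀ : Type u} [NormedAddCommGroup H₀] [InnerProductSpace ℂ H₀] [CompleteSpace H₀]
variable (N : VonNeumannAlgebra H₀) (e : C ≃⋆ₐ[ℂ] N.toStarSubalgebra)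
variable {H : Type u} [NormedAddCommGroup H] [InnerProductSpace ℂ H] [CompleteSpace H]
  {π : C →⋆ₐ[ℂ] (H →L[ℂ] H)}

/-- The ranges of the module maps from `H₀` to a normal Hilbert module are total. -/
theorem IsNormalRep.eq_zero_of_forall_intertwines (hπ : IsNormalRep π) {x : H}
    (h : ∀ A : H₀ →L[ℂ] H, Intertwines (vnRep N e) π A → ∀ z, ⟪A z, x⟫_ℂ = 0) : x = 0 := by
  refine hπ.eq_zero_of_singular N e fun z ε hε => ?_
  set ρ := vnRep N e
  let R : C → WithLp 2 (H₀ × H) → WithLp 2 (H₀ × H) := fun c v => WithLp.toLp 2 (ρ c v.fst, π c v.snd)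
  let L : C →ₗ[ℂ] WithLp 2 (H₀ × H) :=
    { toFun := fun c => WithLp.toLp 2 (ρ c z, π c x)
      map_add' := fun c d => by
        rw [map_add, map_add, add_apply, add_apply]; rfl
      map_smul' := fun l c => by
        rw [map_smul, map_smul, smul_apply, smul_apply]; rfl }
  -- `U` is the closed cyclic submodule generated by `(z, x)`. Its projection commutes with `C`, so
  -- the corner `A : H₀ → H` of that projection is a module map.
  let U : Submodule ℂ (WithLp 2 (H₀ × H)) := (LinearMap.range L).topologicalClosure
  have hUc : IsClosed (U : Set (WithLp 2 (H₀ × H))) := Submodule.isClosed_topologicalClosure _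
  have : CompleteSpace U := hUc.completeSpace_coe
  have hRc : ∀ c, Continuous (R c) := fun c => by
    refine (WithLp.prod_continuous_toLp 2 H₀ H).comp ?_
    exact ((ρ c).continuous.comp (WithLp.fstL 2 ℂ H₀ H).continuous).prodMk
      ((π c).continuous.comp (WithLp.sndL 2 ℂ H₀ H).continuous)
  have hRU : ∀ c, ∀ v ∈ U, R c v ∈ U := by
    intro c
    have hmaps : Set.MapsTo (R c) (Set.range L) (Set.range L) := by
      rintro _ ⟨d, rfl⟩
      refine ⟨c * d, ?_⟩
      simp only [L, R, LinearMap.coe_mk, AddHom.coe_mk, map_mul, mul_apply_eq_comp]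
      rfl
    intro v hv
    exact hmaps.closure (hRc c) hv
  have hRsub : ∀ c v w, R c (v - w) = R c v - R c w := fun c v w => by
    simp only [R, WithLp.sub_fst, WithLp.sub_snd, map_sub]; rfl
  have hRadj : ∀ c v w, ⟪R c v, w⟫_ℂ = ⟪v, R (star c) w⟫_ℂ := fun c v w => by
    rw [WithLp.prod_inner_apply, WithLp.prod_inner_apply]
    exact congrArg₂ _ (StarAlgHom.inner_apply_left _ c _ _) (StarAlgHom.inner_apply_left _ c _ _)
  have hcomm : ∀ c v, U.starProjection (R c v) = R c (U.starProjection v) := fun c =>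
    U.starProjection_apply_of_invariant (hRU c) (hRU (star c)) (hRsub c) (hRadj c)
  let ι : H₀ →L[ℂ] WithLp 2 (H₀ × H) := (WithLp.prodContinuousLinearEquiv 2 ℂ H₀ H).symm.toContinuousLinearMap ∘L
    ContinuousLinearMap.inl ℂ H₀ H
  have hι : ∀ y, ι y = WithLp.toLp 2 (y, 0) := fun y => rfl
  let A : H₀ →L[ℂ] H := WithLp.sndL 2 ℂ H₀ H ∘L U.starProjection ∘L ι
  have hA : ∀ y, A y = (U.starProjection (ι y)).snd := fun y => rfl
  have hint : Intertwines ρ π A := by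
    intro c y
    have : ι (ρ c y) = R c (ι y) := by
      rw [hι, hι]; simp [R]
    rw [hA, this, hcomm, hA]
    rfl
  have hzx : WithLp.toLp 2 (z, x) ∈ U := by
    refine Submodule.le_topologicalClosure _ ⟨1, ?_⟩
    simp [L]
  -- The residual `r = (z, 0) - P` is orthogonal to `U`, hence to `(z, x)` and `P`. Its second
  -- component is `-A z`, so the hypothesis on `x` makes it orthogonal to `(0, x)` too. Thus `r` is
  -- orthogonal to itself.
  have hmem : ι z ∈ U := by
    have h0 := h A hint z
    rw [hA] at h0
    set P := U.starProjection (ι z)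
    have hdecomp : ι z = WithLp.toLp 2 (z, x) - WithLp.toLp 2 (0, x) := by
      rw [hι, ← WithLp.toLp_sub]; simp
    have horth : ∀ u ∈ U, ⟪ι z - P, u⟫_ℂ = 0 :=
      (Submodule.mem_orthogonal' _ _).1 (U.sub_starProjection_mem_orthogonal (ι z))
    have h1 : ⟪ι z - P, WithLp.toLp 2 (z, x)⟫_ℂ = 0 := horth _ hzx
    have h2 : ⟪ι z - P, WithLp.toLp 2 (0, x)⟫_ℂ = 0 := by
      rw [WithLp.prod_inner_apply]
      simp [hι, h0]
    have h3 : ⟪ι z - P, ι z - P⟫_ℂ = 0 := by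
      rw [inner_sub_right, horth P (U.starProjection_apply_mem _), sub_zero]
      nth_rw 2 [hdecomp]
      rw [inner_sub_right, h1, h2, sub_zero]
    rw [inner_self_eq_zero, sub_eq_zero] at h3
    rw [h3]
    exact U.starProjection_apply_mem _
  -- Approximating `(z, 0)` by `(c z, c x)` is exactly singularity of `x` to `z`.
  obtain ⟨_, ⟨c, rfl⟩, hc⟩ := Metric.mem_closure_iff.1 hmem ε hε
  rw [dist_eq_norm, norm_sub_rev] at hc
  refine ⟨c, ?_, ?_⟩
  · exact (WithLp.norm_fst_le (p := 2) _ (L c - ι z)).trans hc.le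
  · have := (WithLp.norm_snd_le (p := 2) _ (L c - ι z)).trans hc.le
    have h2 : (L c - ι z).snd = π c x := by
      rw [WithLp.sub_snd, hι]; simp [L]
    rwa [h2] at this

end Generator

/-! ### Operator-valued bilinear maps as competitors for `ν_C`. -/

section OperatorBimodule

variable {C : Type u} [CommCStarAlgebra C]
variable {H : Type u} [NormedAddCommGroup H] [InnerProductSpace ℂ H] [CompleteSpace H]
variable {K : Type u} [NormedAddCommGroup K] [InnerProductSpace ℂ K] [CompleteSpace K]

/-- The left action of `C` on `B(K, H)` through a representation on `H`. -/
noncomputable abbrev leftOperatorModule (π : C →⋆ₐ[ℂ] (H →L[ℂ] H)) : Module C (K →L[ℂ] H) where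
  smul c T := π c ∘L T
  one_smul T := by change π 1 ∘L T = T; rw [map_one]; rfl
  mul_smul c d T := by change π (c * d) ∘L T = π c ∘L (π d ∘L T); rw [map_mul]; rfl
  smul_zero c := by change π c ∘L 0 = 0; simp
  smul_add c S T := by change π c ∘L (S + T) = π c ∘L S + π c ∘L T; simp
  add_smul c d T := by change π (c + d) ∘L T = π c ∘L T + π d ∘L T; rw [map_add]; rfl
  zero_smul T := by change π 0 ∘L T = 0; rw [map_zero]; rfl

/-- The right action of `C` on `B(K, H)` through a representation on `K`. -/
noncomputable abbrev rightOperatorModule (σ : C →⋆ₐ[ℂ] (K →L[ℂ] K)) : Module Cᵐᵒᵖ (K →L[ℂ] H) where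
  smul c T := T ∘L σ c.unop
  one_smul T := by change T ∘L σ 1 = T; rw [map_one]; rfl
  mul_smul c d T := by
    change T ∘L σ (d.unop * c.unop) = (T ∘L σ d.unop) ∘L σ c.unop; rw [map_mul]; rfl
  smul_zero c := by change 0 ∘L σ c.unop = 0; simp
  smul_add c S T := by change (S + T) ∘L σ c.unop = S ∘L σ c.unop + T ∘L σ c.unop; simp
  add_smul c d T := by
    change T ∘L σ (c.unop + d.unop) = T ∘L σ c.unop + T ∘L σ d.unop; rw [map_add]; simp
  zero_smul T := by change T ∘L σ 0 = 0; rw [map_zero]; simp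

variable [PartialOrder C]
variable {X : Type u} [NormedAddCommGroup X] [NormedSpace ℂ X] [Module C X]
variable {Y : Type u} [NormedAddCommGroup Y] [NormedSpace ℂ Y]
  [Module C Y] [Module Cᵐᵒᵖ Y] [IsCentralScalar C Y]

/-- Bilinear contractions into `B(K, H)` contribute to `ν_C`. -/
theorem norm_lift_mem_nuValues {π : C →⋆ₐ[ℂ] (H →L[ℂ] H)} {σ : C →⋆ₐ[ℂ] (K →L[ℂ] K)}
    (hπ : IsNormalRep π) (hσ : IsNormalRep σ) (φ : X →ₗ[ℂ] Y →ₗ[ℂ] (K →L[ℂ] H))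
    (hl : ∀ c x y, φ (c • x) y = π c ∘L φ x y) (hm : ∀ (c : C) x y, φ (c • x) y = φ x (c • y))
    (hr : ∀ (c : C) x y, φ x (c • y) = φ x y ∘L σ c) (hφ : ∀ x y, ‖φ x y‖ ≤ ‖x‖ * ‖y‖)
    {ι : Type*} (s : Finset ι) (x : ι → X) (y : ι → Y) :
    ‖∑ i ∈ s, φ (x i) (y i)‖ ∈ nuValues C X Y (∑ i ∈ s, x i ⊗ₜ[C] y i) := by
  let _ := leftOperatorModule (K := K) π
  let _ := rightOperatorModule (H := H) σ
  have t1 : IsScalarTower ℂ C (K →L[ℂ] H) := ⟨fun l c T => by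
    change π (l • c) ∘L T = l • (π c ∘L T); rw [map_smul]; rfl⟩
  have t2 : IsScalarTower ℂ Cᵐᵒᵖ (K →L[ℂ] H) := ⟨fun l c T => by
    change T ∘L σ (l • c.unop) = l • (T ∘L σ c.unop); rw [map_smul]; simp⟩
  have t3 : SMulCommClass C Cᵐᵒᵖ (K →L[ℂ] H) := ⟨fun c d T => rfl⟩
  let φ' : X →ₗ[C] Y →ₗ[C] (K →L[ℂ] H) := LinearMap.mk₂ C (fun x y => φ x y)
    (fun x x' y => by rw [map_add]; rfl) (fun c x y => hl c x y)
    (fun x y y' => map_add _ _ _) (fun c x y => by rw [← hm]; exact hl c x y)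
  refine ⟨K →L[ℂ] H, inferInstance, inferInstance, inferInstance, inferInstance, t1,
    inferInstance, t2, t3, φ', ⟨H, inferInstance, inferInstance, inferInstance, K, inferInstance,
      inferInstance, inferInstance, π, σ, LinearIsometry.id, hπ, hσ, fun c T => ⟨rfl, rfl⟩⟩,
    fun c x y => ?_, hφ, ?_⟩
  · rw [op_smul_eq_smul]
    exact hr c x y
  · rw [map_sum]
    rfl

variable [IsScalarTower ℂ C X] [Module Cᵐᵒᵖ X] [IsCentralScalar C X] [IsScalarTower ℂ C Y]

/-- A module map between Hilbert modules defines a `C`-bilinear map by composition. -/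
theorem sum_comp_eq_zero_of_nuSeminorm_eq_zero
    {H' : Type u} [NormedAddCommGroup H'] [InnerProductSpace ℂ H'] [CompleteSpace H']
    {K' : Type u} [NormedAddCommGroup K'] [InnerProductSpace ℂ K'] [CompleteSpace K']
    {π : C →⋆ₐ[ℂ] (H →L[ℂ] H)} {σ : C →⋆ₐ[ℂ] (K →L[ℂ] K)} {T : X →ₗᵢ[ℂ] (K →L[ℂ] H)}
    (hπ : IsNormalRep π)
    (hT : ∀ (c : C) (x : X), T (c • x) = (π c) ∘L (T x) ∧
      T (MulOpposite.op c • x) = (T x) ∘L (σ c))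
    {π' : C →⋆ₐ[ℂ] (H' →L[ℂ] H')} {σ' : C →⋆ₐ[ℂ] (K' →L[ℂ] K')} {T' : Y →ₗᵢ[ℂ] (K' →L[ℂ] H')}
    (hσ' : IsNormalRep σ')
    (hT' : ∀ (c : C) (y : Y), T' (c • y) = (π' c) ∘L (T' y) ∧
      T' (MulOpposite.op c • y) = (T' y) ∘L (σ' c))
    {V : H' →L[ℂ] K} (hV : Intertwines π' σ V)
    {ι : Type*} (s : Finset ι) (x : ι → X) (y : ι → Y)
    (hw : nuSeminorm C X Y (∑ i ∈ s, x i ⊗ₜ[C] y i) = 0) :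
    ∑ i ∈ s, T (x i) ∘L (V ∘L T' (y i)) = 0 := by
  -- Dividing by `‖V‖ + 1` makes the map a contraction, and the extra `1` covers `V = 0`.
  have hr : 0 < ‖V‖ + 1 := by positivity
  let r : ℂ := ((‖V‖ + 1)⁻¹ : ℝ)
  have hr0 : r ≠ 0 := Complex.ofReal_ne_zero.2 (inv_ne_zero hr.ne')
  have hrn : ‖r‖ = (‖V‖ + 1)⁻¹ := by
    rw [Complex.norm_real, Real.norm_eq_abs, abs_of_pos (inv_pos.2 hr)]
  let φ : X →ₗ[ℂ] Y →ₗ[ℂ] (K' →L[ℂ] H) :=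
    LinearMap.mk₂ ℂ (fun x y => r • (T x ∘L (V ∘L T' y)))
      (fun x x' y => by simp) (fun l x y => by
        simp only [map_smul, ContinuousLinearMap.smul_comp, smul_comm r l])
      (fun x y y' => by simp) (fun l x y => by
        simp only [map_smul, ContinuousLinearMap.comp_smul, smul_comm r l])
  have hφ : ∀ x y, φ x y = r • (T x ∘L (V ∘L T' y)) := fun x y => rfl
  have hmem := norm_lift_mem_nuValues (X := X) (Y := Y) hπ hσ' φ
    (fun c x y => by rw [hφ, hφ, (hT c x).1]; ext z; simp)
    (fun c x y => by
      -- Centrality of `X` turns `c x` into `x c`, so `c` acts through `σ` next to `V`, which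
      -- carries it to `π'`.
      rw [hφ, hφ, ← op_smul_eq_smul c x, (hT c x).2, (hT' c y).1]
      ext z
      simp only [smul_apply, ContinuousLinearMap.comp_apply, hV c])
    (fun c x y => by rw [hφ, hφ, ← op_smul_eq_smul c y, (hT' c y).2]; ext z; simp)
    (fun x y => by
      rw [hφ, norm_smul, hrn, inv_mul_le_iff₀ hr]
      calc ‖T x ∘L (V ∘L T' y)‖ ≤ ‖T x‖ * (‖V‖ * ‖T' y‖) :=
            (ContinuousLinearMap.opNorm_comp_le _ _).trans
              (mul_le_mul_of_nonneg_left (ContinuousLinearMap.opNorm_comp_le _ _) (norm_nonneg _))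
        _ = ‖V‖ * (‖x‖ * ‖y‖) := by rw [T.norm_map, T'.norm_map]; ring
        _ ≤ (‖V‖ + 1) * (‖x‖ * ‖y‖) := by gcongr; simp) s x y
  have h0 : ‖∑ i ∈ s, φ (x i) (y i)‖ ≤ 0 := (le_csSup (nuValues_bddAbove _) hmem).trans hw.le
  have h1 : r • ∑ i ∈ s, T (x i) ∘L (V ∘L T' (y i)) = 0 := by
    rw [Finset.smul_sum]
    exact norm_le_zero_iff.1 h0
  exact (smul_eq_zero.1 h1).resolve_left hr0

end OperatorBimodule

/-! ### Matrices over `C` from the double commutant. -/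

section Entries

variable {C : Type u} [CommCStarAlgebra C]
variable {H₀ : Type u} [NormedAddCommGroup H₀] [InnerProductSpace ℂ H₀] [CompleteSpace H₀]

/-- An operator on `H₀ⁿ` commuting with the diagonal action of the commutant of `N` has entries
in `N`. -/
theorem exists_entries_of_commute {ι : Type*} [Fintype ι] [DecidableEq ι]
    (N : VonNeumannAlgebra H₀) (e : C ≃⋆ₐ[ℂ] N.toStarSubalgebra)
    (Q : PiLp 2 (fun _ : ι => H₀) →L[ℂ] PiLp 2 (fun _ : ι => H₀))
    (hQ : ∀ t ∈ N.commutant, ∀ v : PiLp 2 (fun _ : ι => H₀),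
      Q (WithLp.toLp 2 fun i => t (v i)) = WithLp.toLp 2 fun i => t (Q v i)) :
    ∃ q : ι → ι → C, ∀ v j, Q v j = ∑ k, vnRep N e (q j k) (v k) := by
  let Qe : ι → ι → (H₀ →L[ℂ] H₀) := fun j k =>
    PiLp.proj 2 (fun _ : ι => H₀) j ∘L Q ∘L
      ((PiLp.continuousLinearEquiv 2 ℂ (fun _ : ι => H₀)).symm.toContinuousLinearMap ∘L
        ContinuousLinearMap.single ℂ (fun _ : ι => H₀) k)
  have hQe : ∀ j k z, Qe j k z = Q (WithLp.toLp 2 (Pi.single k z)) j := fun j k z => rfl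
  have hmem : ∀ j k, Qe j k ∈ N := by
    intro j k
    rw [← VonNeumannAlgebra.commutant_commutant N, VonNeumannAlgebra.mem_commutant_iff]
    intro t ht
    refine ContinuousLinearMap.ext fun z => ?_
    have := congrArg (fun v => v j) (hQ t ht (WithLp.toLp 2 (Pi.single k z)))
    rw [mul_apply_eq_comp, mul_apply_eq_comp, hQe, hQe]
    have hs : (WithLp.toLp 2 fun i => t ((Pi.single k z : ι → H₀) i) : PiLp 2 fun _ : ι => H₀) =
        WithLp.toLp 2 (Pi.single k (t z)) := by
      ext i
      rcases eq_or_ne i k with rfl | hik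
      · simp
      · simp [hik]
    rw [← hs]
    exact this.symm
  choose q hq using fun j k => exists_vnRep_eq e (hmem j k)
  refine ⟨q, fun v j => ?_⟩
  have hv : v = ∑ k, WithLp.toLp 2 (Pi.single k (v k)) := by
    ext i
    simp [Finset.sum_apply, Pi.single_apply]
  conv_lhs => rw [hv, map_sum]
  simp only [hq, hQe]
  simp

end Entries

/-! ### Faithfulness of `ν_C`. -/

section Faithful

variable {C : Type u} [CommCStarAlgebra C] [PartialOrder C] [StarOrderedRing C]
variable {H₀ : Type u} [NormedAddCommGroup H₀] [InnerProductSpace ℂ H₀] [CompleteSpace H₀]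
variable (N : VonNeumannAlgebra H₀) (e : C ≃⋆ₐ[ℂ] N.toStarSubalgebra)
variable {H : Type u} [NormedAddCommGroup H] [InnerProductSpace ℂ H] [CompleteSpace H]
variable {K : Type u} [NormedAddCommGroup K] [InnerProductSpace ℂ K] [CompleteSpace K]

/-- Module maps from `H₀` separate the operators between normal Hilbert modules. -/
theorem IsNormalRep.operator_eq_zero {π : C →⋆ₐ[ℂ] (H →L[ℂ] H)} {σ : C →⋆ₐ[ℂ] (K →L[ℂ] K)}
    (hπ : IsNormalRep π) (hσ : IsNormalRep σ) {S : K →L[ℂ] H}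
    (h : ∀ A : H₀ →L[ℂ] H, Intertwines (vnRep N e) π A → ∀ B : H₀ →L[ℂ] K,
      Intertwines (vnRep N e) σ B → ∀ z, ContinuousLinearMap.adjoint A (S (B z)) = 0) : S = 0 := by
  have h1 : ∀ B : H₀ →L[ℂ] K, Intertwines (vnRep N e) σ B → ∀ z, S (B z) = 0 := by
    intro B hB z
    refine hπ.eq_zero_of_forall_intertwines N e fun A hA z' => ?_
    rw [← ContinuousLinearMap.adjoint_inner_right, h A hA B hB z, inner_zero_right]
  have h2 : ContinuousLinearMap.adjoint S = 0 := by
    ext y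
    refine hσ.eq_zero_of_forall_intertwines N e fun B hB z => ?_
    rw [ContinuousLinearMap.adjoint_inner_right, h1 B hB z, inner_zero_left]
  rw [← ContinuousLinearMap.adjoint_adjoint S, h2, map_zero]

variable {X : Type u} [NormedAddCommGroup X] [NormedSpace ℂ X] [CompleteSpace X]
  [Module C X] [IsScalarTower ℂ C X] [Module Cᵐᵒᵖ X] [IsCentralScalar C X]
variable {Y : Type u} [NormedAddCommGroup Y] [NormedSpace ℂ Y] [CompleteSpace Y]
  [Module C Y] [IsScalarTower ℂ C Y] [Module Cᵐᵒᵖ Y] [IsCentralScalar C Y]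

/-- The vanishing of `∑ T(x_i) V T'(y_i)` for all module maps `V` is converted into an algebraic
certificate: a matrix over `C` that annihilates the `x_j` and reproduces the `y_j`. -/
theorem eq_zero_of_nuSeminorm_eq_zero (N : VonNeumannAlgebra H₀)
    (e : C ≃⋆ₐ[ℂ] N.toStarSubalgebra) (hX : IsNormalRepresentable C X)
    (hY : IsNormalRepresentable C Y) (w : X ⊗[C] Y) (hw : nuSeminorm C X Y w = 0) : w = 0 := by
  classical
  obtain ⟨H, _, _, _, K, _, _, _, π, σ, T, hπ, hσ, hT⟩ := hX
  obtain ⟨H', _, _, _, K', _, _, _, π', σ', T', hπ', hσ', hT'⟩ := hY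
  obtain ⟨s, hs⟩ := TensorProduct.exists_finset w
  rw [← Finset.sum_coe_sort] at hs
  let x : s → X := fun i => i.1.1
  let y : s → Y := fun i => i.1.2
  have hs' : w = ∑ i, x i ⊗ₜ[C] y i := hs
  clear_value x y
  clear hs
  subst hs'
  set ρ := vnRep N e with hρ
  have hcomm : ∀ (c : C) (x : X) k, π c (T x k) = T x (σ c k) := fun c x k => by
    have := (hT c x).2
    rw [op_smul_eq_smul, (hT c x).1] at this
    exact congrArg (fun S : K →L[ℂ] H => S k) this
  let F : Submodule ℂ (PiLp 2 fun _ : s => H₀) :=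
    { carrier := {v | ∀ A : H₀ →L[ℂ] H, Intertwines ρ π A → ∀ B : H₀ →L[ℂ] K, Intertwines ρ σ B →
        ∑ i, ContinuousLinearMap.adjoint A (T (x i) (B (v i))) = 0}
      zero_mem' := fun A _ B _ => by simp
      add_mem' := fun {v w} hv hw A hA B hB => by
        simp only [PiLp.add_apply, map_add, Finset.sum_add_distrib, hv A hA B hB, hw A hA B hB,
          add_zero]
      smul_mem' := fun l v hv A hA B hB => by
        simp only [PiLp.smul_apply, map_smul, ← Finset.smul_sum, hv A hA B hB, smul_zero] }
  have hF : ∀ v, v ∈ F ↔ ∀ A : H₀ →L[ℂ] H, Intertwines ρ π A → ∀ B : H₀ →L[ℂ] K,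
      Intertwines ρ σ B → ∑ i, ContinuousLinearMap.adjoint A (T (x i) (B (v i))) = 0 :=
    fun v => Iff.rfl
  have hFc : IsClosed (F : Set (PiLp 2 fun _ : s => H₀)) := by
    have : (F : Set (PiLp 2 fun _ : s => H₀)) = ⋂ (A : H₀ →L[ℂ] H) (_ : Intertwines ρ π A)
        (B : H₀ →L[ℂ] K) (_ : Intertwines ρ σ B),
        {v | ∑ i, ContinuousLinearMap.adjoint A (T (x i) (B (v i))) = 0} := by
      ext v
      simp only [Set.mem_iInter, SetLike.mem_coe, hF, Set.mem_ofPred_eq]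
    rw [this]
    refine isClosed_iInter fun A => isClosed_iInter fun _ => isClosed_iInter fun B =>
      isClosed_iInter fun _ => isClosed_eq ?_ continuous_const
    fun_prop
  have : CompleteSpace F := hFc.completeSpace_coe
  -- `B ∘L t` is again a module map, and the condition defining `F` quantifies over all of them.
  have hinv : ∀ t ∈ N.commutant, ∀ v ∈ F, WithLp.toLp 2 (fun i => t (v i)) ∈ F := by
    intro t ht v hv A hA B hB
    refine hv A hA (B ∘L t) fun c z => ?_
    have := congrArg (fun S : H₀ →L[ℂ] H₀ => S z)
      (VonNeumannAlgebra.mem_commutant_iff.1 ht _ (vnRep_mem N e c))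
    rw [ContinuousLinearMap.comp_apply, ContinuousLinearMap.comp_apply, ← hB c]
    exact congrArg B this.symm
  obtain ⟨q, hq⟩ := exists_entries_of_commute N e F.starProjection fun t ht v =>
    F.starProjection_apply_of_invariant (T := fun v => WithLp.toLp 2 fun i => t (v i))
      (T' := fun v => WithLp.toLp 2 fun i => star t (v i)) (hinv t ht)
      (hinv _ (star_mem ht)) (fun v w => by ext; simp) (fun v w => by
        simp [PiLp.inner_apply, ContinuousLinearMap.star_eq_adjoint,
          ContinuousLinearMap.adjoint_inner_right]) v
  -- the columns of the projection annihilate the vectors `x j`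
  have hx : ∀ k, ∑ j, q j k • x j = 0 := by
    intro k
    refine (map_eq_zero_iff T T.injective).1 ?_
    refine hπ.operator_eq_zero N e hσ fun A hA B hB z => ?_
    have := (hF _).1 (F.starProjection_apply_mem (WithLp.toLp 2 (Pi.single k z))) A hA B hB
    rw [← this, map_sum, sum_apply, map_sum]
    refine Finset.sum_congr rfl fun j _ => ?_
    have h1 : F.starProjection (WithLp.toLp 2 (Pi.single k z)) j = ρ (q j k) z := by
      rw [hq, Finset.sum_eq_single k]
      · simp [hρ]
      · intro i _ hik; simp [hik]
      · simp
    rw [h1, hB, ← hcomm, (hT _ _).1]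
    rfl
  -- the rows of the projection reproduce the vectors `y j`
  have hy : ∀ j, y j = ∑ k, q j k • y k := by
    intro j
    rw [← sub_eq_zero]
    refine (map_eq_zero_iff T' T'.injective).1 ?_
    refine hπ'.operator_eq_zero N e hσ' fun A' hA' B' hB' z => ?_
    -- This is where `ν_C(w) = 0` enters, applied to `V = B A'^*`. The projection then fixes this
    -- tuple.
    have hmem : WithLp.toLp 2 (fun i => ContinuousLinearMap.adjoint A' (T' (y i) (B' z))) ∈ F := by
      intro A hA B hB
      have hV : Intertwines π' σ (B ∘L ContinuousLinearMap.adjoint A') := fun c h => by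
        rw [ContinuousLinearMap.comp_apply, hA'.adjoint c h, hB]; rfl
      have := congrArg (fun S : K' →L[ℂ] H => ContinuousLinearMap.adjoint A (S (B' z)))
        (sum_comp_eq_zero_of_nuSeminorm_eq_zero hπ hT hσ' hT' hV Finset.univ x y hw)
      simpa using this
    have h1 := congrArg (fun v => v j) (F.starProjection_eq_self_iff.2 hmem)
    beta_reduce at h1
    rw [hq] at h1
    rw [map_sub, sub_apply, map_sub, sub_eq_zero]
    refine h1.symm.trans ?_
    rw [map_sum, sum_apply, map_sum]
    refine Finset.sum_congr rfl fun k _ => ?_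
    rw [(hT' _ _).1, ContinuousLinearMap.comp_apply, hA'.adjoint]
  -- The entries move across the balanced tensor, where summing over `j` first produces the
  -- vanishing columns.
  have hz : ∀ j, x j ⊗ₜ[C] y j = ∑ k, (q j k • x j) ⊗ₜ[C] y k := fun j => by
    conv_lhs => rw [hy j, TensorProduct.tmul_sum]
    simp only [TensorProduct.tmul_smul, TensorProduct.smul_tmul']
  simp only [hz]
  rw [Finset.sum_comm]
  simp only [← TensorProduct.sum_tmul, hx, TensorProduct.zero_tmul, Finset.sum_const_zero]

end Faithful

/-! ### Hilbert sums of normal representations. -/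

section DirectSum

variable {C : Type u} [CommCStarAlgebra C]
variable {ι : Type u} {H : ι → Type u} [∀ i, NormedAddCommGroup (H i)]
  [∀ i, InnerProductSpace ℂ (H i)] [∀ i, CompleteSpace (H i)]

/-- The Hilbert space direct sum of a family of representations. -/
noncomputable def lpRep (π : ∀ i, C →⋆ₐ[ℂ] (H i →L[ℂ] H i)) :
    C →⋆ₐ[ℂ] (lp H 2 →L[ℂ] lp H 2) where
  toFun c := lp.mapCLM 2 (fun i => π i c) (norm_nonneg c)
    fun i => NonUnitalStarAlgHom.norm_apply_le (π i) c
  map_one' := by ext f i; simp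
  map_mul' c d := by ext f i; simp
  map_zero' := by ext f i; simp
  map_add' c d := by ext f i; simp
  commutes' l := by
    ext f i
    simp [Algebra.algebraMap_eq_smul_one]
  map_star' c := by
    rw [ContinuousLinearMap.star_eq_adjoint, ContinuousLinearMap.eq_adjoint_iff]
    intro f g
    rw [lp.inner_eq_tsum, lp.inner_eq_tsum]
    refine tsum_congr fun i => ?_
    simpa using (StarAlgHom.inner_apply_left (π i) (star c) (f i) (g i))

theorem lpRep_apply (π : ∀ i, C →⋆ₐ[ℂ] (H i →L[ℂ] H i)) (c : C) (f : lp H 2) (i : ι) :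
    lpRep π c f i = π i c (f i) := by
  simp [lpRep]

/-- Vectors supported in one coordinate determine operators, and on them each matrix coefficient is
one of a single summand. -/
theorem isNormalRep_lpRep [PartialOrder C] [StarOrderedRing C]
    {π : ∀ i, C →⋆ₐ[ℂ] (H i →L[ℂ] H i)} (hπ : ∀ i, IsNormalRep (π i)) :
    IsNormalRep (lpRep π) := by
  classical
  refine isNormalRep_of_tendsto_inner (V := {f | ∃ i x, f = lp.single 2 i x}) ?_ ?_
  · intro S T h
    refine lp.ext_continuousLinearMap (by simp) fun i => ?_
    ext x : 1
    ext j
    refine ext_inner_right ℂ fun y => ?_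
    have := h _ ⟨i, x, rfl⟩ _ ⟨j, y, rfl⟩
    rwa [lp.inner_single_right, lp.inner_single_right] at this
  · rintro D a hsa hne hdir ha _ ⟨i, x, rfl⟩ _ ⟨j, y, rfl⟩
    simp only [lp.inner_single_right, lpRep_apply]
    exact (hπ j).tendsto_inner hsa hne hdir ha _ _

end DirectSum

/-! ### Isometric representations and their completions. -/

section Representation

variable {C : Type u} [CommCStarAlgebra C] [PartialOrder C]
variable {V : Type u} [SeminormedAddCommGroup V] [NormedSpace ℂ V] [Module C V] [Module Cᵐᵒᵖ V]

/-- A seminormed bimodule whose seminorm is a supremum of seminorms defined by contractive normal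
representations has an isometric normal representation. -/
theorem exists_isometric_normal_representation [StarOrderedRing C]
    (h : ∀ (v : V) (n : ℕ), ∃ (H : Type u) (_ : NormedAddCommGroup H) (_ : InnerProductSpace ℂ H)
      (_ : CompleteSpace H) (K : Type u) (_ : NormedAddCommGroup K) (_ : InnerProductSpace ℂ K)
      (_ : CompleteSpace K) (π : C →⋆ₐ[ℂ] (H →L[ℂ] H)) (σ : C →⋆ₐ[ℂ] (K →L[ℂ] K))
      (T : V →ₗ[ℂ] (K →L[ℂ] H)),
      IsNormalRep π ∧ IsNormalRep σ ∧
      (∀ (c : C) (x : V), T (c • x) = (π c) ∘L (T x) ∧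
        T (MulOpposite.op c • x) = (T x) ∘L (σ c)) ∧
      (∀ x, ‖T x‖ ≤ ‖x‖) ∧ ‖v‖ - 1 / ((n : ℝ) + 1) ≤ ‖T v‖) :
    ∃ (H : Type u) (_ : NormedAddCommGroup H) (_ : InnerProductSpace ℂ H)
      (_ : CompleteSpace H) (K : Type u) (_ : NormedAddCommGroup K) (_ : InnerProductSpace ℂ K)
      (_ : CompleteSpace K) (π : C →⋆ₐ[ℂ] (H →L[ℂ] H)) (σ : C →⋆ₐ[ℂ] (K →L[ℂ] K))
      (T : V →ₗᵢ[ℂ] (K →L[ℂ] H)),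
      IsNormalRep π ∧ IsNormalRep σ ∧
      ∀ (c : C) (x : V), T (c • x) = (π c) ∘L (T x) ∧
        T (MulOpposite.op c • x) = (T x) ∘L (σ c) := by
  classical
  -- One representation for each vector and each precision `1 / (n + 1)` is enough, and this index
  -- set stays in the universe `u`.
  have h' := fun i : V × ℕ => h i.1 i.2
  choose H _ _ _ K _ _ _ π σ T hπ hσ hT hle hge using h'
  let S : V →ₗ[ℂ] (lp K 2 →L[ℂ] lp H 2) :=
    { toFun := fun v => lp.mapCLM 2 (fun i => T i v) (norm_nonneg v) fun i => hle i v
      map_add' := fun v w => by ext f i; simp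
      map_smul' := fun l v => by ext f i; simp }
  have hS : ∀ v f i, S v f i = T i v (f i) := fun v f i => by simp [S]
  have hSle : ∀ v, ‖S v‖ ≤ ‖v‖ := fun v => 
    lp.norm_mapCLM_le 2 (fun i => T i v) (norm_nonneg v) fun i => hle i v
  have hSge : ∀ v i, ‖T i v‖ ≤ ‖S v‖ := fun v i => by
    refine ContinuousLinearMap.opNorm_le_bound _ (S v).opNorm_nonneg fun x => ?_
    have h1 : S v (lp.single 2 i x) i = T i v x := by rw [hS, lp.single_apply_self]
    rw [← h1]
    refine (lp.norm_apply_le_norm two_ne_zero _ i).trans ?_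
    refine ((S v).le_opNorm _).trans_eq ?_
    rw [lp.norm_single (by simp)]
  refine ⟨lp H 2, inferInstance, inferInstance, inferInstance, lp K 2, inferInstance,
    inferInstance, inferInstance, lpRep π, lpRep σ, ⟨S, fun v => le_antisymm (hSle v) ?_⟩,
    isNormalRep_lpRep hπ, isNormalRep_lpRep hσ, fun c v => ⟨?_, ?_⟩⟩
  · have hlim : Tendsto (fun n : ℕ => ‖v‖ - 1 / ((n : ℝ) + 1)) atTop (𝓝 ‖v‖) := by
      simpa using tendsto_const_nhds.sub (tendsto_one_div_add_atTop_nhds_zero_nat (𝕜 := ℝ))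
    exact le_of_tendsto' hlim fun n => (hge (v, n)).trans (hSge v _)
  · ext f i
    change S (c • v) f i = lpRep π c (S v f) i
    rw [lpRep_apply, hS, hS, (hT i c v).1]
    rfl
  · ext f i
    change S (MulOpposite.op c • v) f i = S v (lpRep σ c f) i
    rw [hS, hS, lpRep_apply, (hT i c v).2]
    rfl

/-- An isometric normal representation extends to the completion. -/
theorem isNormalRepresentable_completion [UniformContinuousConstSMul C V]
    [UniformContinuousConstSMul Cᵐᵒᵖ V]
    (h : ∃ (H : Type u) (_ : NormedAddCommGroup H) (_ : InnerProductSpace ℂ H)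
      (_ : CompleteSpace H) (K : Type u) (_ : NormedAddCommGroup K) (_ : InnerProductSpace ℂ K)
      (_ : CompleteSpace K) (π : C →⋆ₐ[ℂ] (H →L[ℂ] H)) (σ : C →⋆ₐ[ℂ] (K →L[ℂ] K))
      (T : V →ₗᵢ[ℂ] (K →L[ℂ] H)),
      IsNormalRep π ∧ IsNormalRep σ ∧
      ∀ (c : C) (x : V), T (c • x) = (π c) ∘L (T x) ∧
        T (MulOpposite.op c • x) = (T x) ∘L (σ c)) :
    IsNormalRepresentable C (UniformSpace.Completion V) := by
  obtain ⟨H, _, _, _, K, _, _, _, π, σ, T, hπ, hσ, hT⟩ := h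
  let S : UniformSpace.Completion V →L[ℂ] (K →L[ℂ] H) :=
    T.toContinuousLinearMap.extend UniformSpace.Completion.toComplL
  have hS : ∀ v : V, S v = T v := fun v =>
    T.toContinuousLinearMap.extend_eq (e := UniformSpace.Completion.toComplL)
      UniformSpace.Completion.denseRange_coe
      (UniformSpace.Completion.isUniformInducing_coe V) v
  refine ⟨H, inferInstance, inferInstance, inferInstance, K, inferInstance,
    inferInstance, inferInstance, π, σ, ⟨S, fun v => ?_⟩, hπ, hσ, fun c v => ⟨?_, ?_⟩⟩
  · induction v using UniformSpace.Completion.induction_on with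
    | hp => exact isClosed_eq (S.continuous.norm) continuous_norm
    | ih v =>
      change ‖S v‖ = _
      rw [hS, T.norm_map, UniformSpace.Completion.norm_coe]
  · change S (c • v) = π c ∘L S v
    induction v using UniformSpace.Completion.induction_on with
    | hp =>
      exact isClosed_eq (S.continuous.comp (continuous_const_smul c))
        (continuous_const.clm_comp S.continuous)
    | ih v => rw [← UniformSpace.Completion.coe_smul, hS, hS, (hT c v).1]
  · change S (MulOpposite.op c • v) = S v ∘L σ c
    induction v using UniformSpace.Completion.induction_on with
    | hp =>
      exact isClosed_eq (S.continuous.comp (continuous_const_smul _))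
        (S.continuous.clm_comp continuous_const)
    | ih v => rw [← UniformSpace.Completion.coe_smul, hS, hS, (hT c v).2]

end Representation

/-! ### Representability of the normal projective tensor product. -/

section NormalProjTensor

variable {C : Type u} [CommCStarAlgebra C] [PartialOrder C]

/-- The zero map into `X` is a competitor. Nonemptiness allows the supremum to be approximated by
actual values. -/
theorem nuValues_nonempty {X Y : Type u} [NormedAddCommGroup X] [NormedSpace ℂ X] [Module C X]
    [IsScalarTower ℂ C X] [Module Cᵐᵒᵖ X] [IsCentralScalar C X] [NormedAddCommGroup Y] [Module C Y]
    [Module Cᵐᵒᵖ Y] [IsCentralScalar C Y] [CompleteSpace X] (hX : IsNormalRepresentable C X) (w : X ⊗[C] Y) :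
    (nuValues C X Y w).Nonempty := by
  have : IsScalarTower ℂ Cᵐᵒᵖ X := ⟨fun l c x => by
    obtain ⟨c, rfl⟩ := MulOpposite.op_surjective c
    rw [← MulOpposite.op_smul, op_smul_eq_smul, op_smul_eq_smul, smul_assoc]⟩
  exact ⟨0, X, inferInstance, inferInstance, inferInstance, inferInstance, inferInstance,
    inferInstance, inferInstance, inferInstance, 0, hX, fun c x y => by simp,
    fun x y => by
      rw [LinearMap.zero_apply, LinearMap.zero_apply, norm_zero]; positivity, by
      rw [show TensorProduct.lift (0 : X →ₗ[C] Y →ₗ[C] X) = 0 from TensorProduct.ext' fun x y => rfl,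
        LinearMap.zero_apply, norm_zero]⟩

variable {X : Type u} [NormedAddCommGroup X] [NormedSpace ℂ X]
  [Module C X] [IsScalarTower ℂ C X] [Module Cᵐᵒᵖ X] [IsCentralScalar C X]
variable {Y : Type u} [NormedAddCommGroup Y] [NormedSpace ℂ Y]
  [Module C Y] [IsScalarTower ℂ C Y] [Module Cᵐᵒᵖ Y] [IsCentralScalar C Y]

theorem isNormalRepresentable_normalProjTensor [StarOrderedRing C] [CompleteSpace X]
    (hX : IsNormalRepresentable C X) :
    IsNormalRepresentable C (NormalProjTensor C X Y) := by
  refine isNormalRepresentable_completion (exists_isometric_normal_representation fun w n => ?_)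
  obtain ⟨r, hr, hlt⟩ := exists_lt_of_lt_csSup (nuValues_nonempty hX (Y := Y) w)
    (show nuSeminorm C X Y w - 1 / ((n : ℝ) + 1) < sSup (nuValues C X Y w) from
      sub_lt_self _ (by positivity))
  obtain ⟨Z, _, _, _, _, _, _, _, _, φ, hZ, hφr, hφ, rfl⟩ := id hr
  have hφle : ∀ v : X ⊗[C] Y, ‖TensorProduct.lift φ v‖ ≤ nuSeminorm C X Y v := fun v =>
    le_csSup (nuValues_bddAbove v)
      ⟨Z, _, _, ‹_›, _, ‹_›, _, ‹_›, ‹_›, φ, hZ, hφr, hφ, rfl⟩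
  obtain ⟨H, _, _, _, K, _, _, _, π, σ, T, hπ, hσ, hT⟩ := hZ
  let L : X ⊗[C] Y →ₗ[ℂ] Z := (TensorProduct.lift φ).restrictScalars ℂ
  have hLop : ∀ (c : C) (v : X ⊗[C] Y), L (MulOpposite.op c • v) = MulOpposite.op c • L v := by
    intro c v
    induction v using TensorProduct.induction_on with
    | zero => simp
    | tmul x y =>
      rw [op_smul_eq_smul, ← TensorProduct.tmul_smul, ← op_smul_eq_smul c y]
      exact hφr c x y
    | add v w hv hw => rw [smul_add, map_add, hv, hw, map_add, smul_add]
  refine ⟨H, inferInstance, inferInstance, inferInstance, K, inferInstance,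
    inferInstance, inferInstance, π, σ, T.toLinearMap ∘ₗ L, hπ, hσ, fun c v => ⟨?_, ?_⟩, fun v => ?_,
    ?_⟩
  · exact (congrArg T (map_smul (TensorProduct.lift φ) c v)).trans (hT _ _).1
  · exact (congrArg T (hLop c v)).trans (hT _ _).2
  · change ‖T (L v)‖ ≤ nuSeminorm C X Y v
    rw [T.norm_map]
    exact hφle v
  · change nuSeminorm C X Y w - _ ≤ ‖T (L w)‖
    rw [T.norm_map]
    exact hlt.le

theorem op_smul_normalProjTensor (c : C) (w : NormalProjTensor C X Y) :
    MulOpposite.op c • w = c • w := op_smul_eq_smul c w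

theorem nuSeminorm_tmul_le (x : X) (y : Y) : nuSeminorm C X Y (x ⊗ₜ[C] y) ≤ ‖x‖ * ‖y‖ := by
  refine Real.sSup_le ?_ (by positivity)
  rintro r ⟨Z, _, _, _, _, _, _, _, _, φ, -, -, hφ, rfl⟩
  simpa using hφ x y

end NormalProjTensor

/-! ### Universal property and maximality. -/

section UniversalProperty

variable {C : Type u} [CommCStarAlgebra C] [PartialOrder C]
variable {X : Type u} [NormedAddCommGroup X] [NormedSpace ℂ X]
  [Module C X] [IsScalarTower ℂ C X] [Module Cᵐᵒᵖ X] [IsCentralScalar C X]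
variable {Y : Type u} [NormedAddCommGroup Y] [NormedSpace ℂ Y]
  [Module C Y] [IsScalarTower ℂ C Y] [Module Cᵐᵒᵖ Y] [IsCentralScalar C Y]
variable (C X Y) in
/-- The canonical map of `X ⊗_C Y` into the normal projective tensor product. -/
noncomputable def nuCoe : X ⊗[C] Y →ₗ[C] NormalProjTensor C X Y where
  toFun w := UniformSpace.Completion.coe' (α := NuTensor C X Y) w
  map_add' v w := UniformSpace.Completion.coe_add (α := NuTensor C X Y) v w
  map_smul' c w := UniformSpace.Completion.coe_smul (X := NuTensor C X Y) c w

theorem normalProjTensor_hom_ext {Z : Type*} [NormedAddCommGroup Z] [NormedSpace ℂ Z]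
    {f g : NormalProjTensor C X Y →L[ℂ] Z}
    (h : ∀ x y, f (nuTmul x y) = g (nuTmul x y)) : f = g := by
  ext w
  induction w using UniformSpace.Completion.induction_on with
  | hp => exact isClosed_eq f.continuous g.continuous
  | ih w =>
    change f (nuCoe C X Y w) = g (nuCoe C X Y w)
    refine TensorProduct.induction_on (motive := fun w : X ⊗[C] Y =>
      f (nuCoe C X Y w) = g (nuCoe C X Y w)) w ?_ h ?_
    · simp only [map_zero]
    · intro v w hv hw
      rw [map_add, map_add, map_add, hv, hw]

variable {Z : Type u} [NormedAddCommGroup Z] [NormedSpace ℂ Z] [CompleteSpace Z]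
  [Module C Z] [IsScalarTower ℂ C Z] [Module Cᵐᵒᵖ Z] [IsCentralScalar C Z]

/-- Only contractions compete in `ν_C`, so `φ` is divided by some `M' > 0` with `M ≤ M'`. Letting
`M'` decrease to `M` covers `M = 0`. -/
theorem norm_lift_le_nuSeminorm (hZ : IsNormalRepresentable C Z) (φ : X →ₗ[C] Y →ₗ[C] Z) {M : ℝ}
    (hM : 0 ≤ M) (hφ : ∀ x y, ‖φ x y‖ ≤ M * (‖x‖ * ‖y‖)) (w : X ⊗[C] Y) :
    ‖TensorProduct.lift φ w‖ ≤ M * nuSeminorm C X Y w := by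
  have t : IsScalarTower ℂ Cᵐᵒᵖ Z := ⟨fun l c z => by
    obtain ⟨c, rfl⟩ := MulOpposite.op_surjective c
    rw [← MulOpposite.op_smul, op_smul_eq_smul, op_smul_eq_smul, smul_assoc]⟩
  have key : ∀ M' : ℝ, 0 < M' → M ≤ M' →
      ‖TensorProduct.lift φ w‖ ≤ M' * nuSeminorm C X Y w := by
    intro M' hM' hMM'
    -- The scalar is taken inside `C` so that `r • φ` is directly a `C`-bilinear map.
    let r : C := algebraMap ℂ C ((M'⁻¹ : ℝ) : ℂ)
    have hr : ∀ z : Z, r • z = ((M'⁻¹ : ℝ) : ℂ) • z := fun z => algebraMap_smul C _ z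
    have hn : ∀ z : Z, ‖r • z‖ = M'⁻¹ * ‖z‖ := fun z => by
      rw [hr, norm_smul, Complex.norm_real, Real.norm_eq_abs, abs_of_pos (inv_pos.2 hM')]
    have hmem : ‖TensorProduct.lift (r • φ) w‖ ∈ nuValues C X Y w := by
      refine ⟨Z, _, _, ‹_›, _, ‹_›, _, t, inferInstance, r • φ, hZ, fun c x y => ?_, fun x y => ?_,
        rfl⟩
      · rw [op_smul_eq_smul, op_smul_eq_smul, map_smul]
      · rw [LinearMap.smul_apply, LinearMap.smul_apply, hn, inv_mul_le_iff₀ hM']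
        exact (hφ x y).trans (mul_le_mul_of_nonneg_right hMM' (by positivity))
    have hlift : TensorProduct.lift (r • φ) w = r • TensorProduct.lift φ w :=
      congrArg (fun f : X ⊗[C] Y →ₗ[C] Z => f w)
        (show TensorProduct.lift (r • φ) = r • TensorProduct.lift φ from
          TensorProduct.ext' fun x y => rfl)
    have h := le_csSup (nuValues_bddAbove w) hmem
    rw [hlift, hn, inv_mul_le_iff₀ hM'] at h
    exact h
  have hlim : Tendsto (fun n : ℕ => (M + 1 / ((n : ℝ) + 1)) * nuSeminorm C X Y w) atTop
      (𝓝 (M * nuSeminorm C X Y w)) := by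
    simpa using (tendsto_const_nhds.add
      (tendsto_one_div_add_atTop_nhds_zero_nat (𝕜 := ℝ))).mul_const (nuSeminorm C X Y w)
  exact ge_of_tendsto' hlim fun n => key _ (by positivity) (by simp; positivity)

theorem norm_nuTmul_le (x : X) (y : Y) : ‖nuTmul (C := C) x y‖ ≤ ‖x‖ * ‖y‖ :=
  (UniformSpace.Completion.norm_coe _).trans_le (nuSeminorm_tmul_le x y)

/-- The bound `‖f‖ ≤ ‖ψ‖` comes from the supremum defining `ν_C`; the converse comes from `ν_C`
being subcross. -/
theorem exists_normalProjTensor_lift (hZ : IsNormalRepresentable C Z) (ψ : X →L[ℂ] Y →L[ℂ] Z)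
    (hψ : ∀ (c : C) (x : X) (y : Y), ψ (c • x) y = c • ψ x y ∧ ψ x (c • y) = c • ψ x y) :
    ∃ f : NormalProjTensor C X Y →L[ℂ] Z,
      (∀ (c : C) (w : NormalProjTensor C X Y), f (c • w) = c • f w) ∧
      (∀ (x : X) (y : Y), f (nuTmul x y) = ψ x y) ∧ ‖f‖ = ‖ψ‖ := by
  let φ : X →ₗ[C] Y →ₗ[C] Z := LinearMap.mk₂ C (fun x y => ψ x y)
    (fun x x' y => by rw [map_add]; rfl) (fun c x y => (hψ c x y).1)
    (fun x y y' => map_add _ _ _) (fun c x y => (hψ c x y).2)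
  have hle := norm_lift_le_nuSeminorm hZ φ (norm_nonneg ψ) fun x y => by
    rw [← mul_assoc]
    exact ψ.le_opNorm₂ x y
  let L₀ : NuTensor C X Y →ₗ[ℂ] Z := (TensorProduct.lift φ).restrictScalars ℂ
  let L : NuTensor C X Y →L[ℂ] Z := L₀.mkContinuous ‖ψ‖ hle
  let f : NormalProjTensor C X Y →L[ℂ] Z := L.extend UniformSpace.Completion.toComplL
  have hf : ∀ v : NuTensor C X Y, f v = TensorProduct.lift φ v := fun v =>
    L.extend_eq (e := UniformSpace.Completion.toComplL)
      UniformSpace.Completion.denseRange_coe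
      (UniformSpace.Completion.isUniformInducing_coe _) v
  have hft : ∀ (x : X) (y : Y), f (nuTmul x y) = ψ x y := fun x y => hf _
  -- Continuity of the action on `Z` is not part of the module structure; it is read off from the
  -- isometric representation.
  have hcsmul : ∀ c : C, Continuous fun z : Z => c • z := by
    intro c
    obtain ⟨H, _, _, _, K, _, _, _, π, σ, T, -, -, hT⟩ := hZ
    rw [T.isometry.isEmbedding.continuous_iff]
    have : (T ∘ fun z : Z => c • z) = fun z => π c ∘L T z := funext fun z => (hT c z).1
    rw [this]
    exact continuous_const.clm_comp T.continuous
  refine ⟨f, fun c w => ?_, hft, le_antisymm ?_ ?_⟩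
  · induction w using UniformSpace.Completion.induction_on with
    | hp =>
      exact isClosed_eq (f.continuous.comp (continuous_const_smul c))
        ((hcsmul c).comp f.continuous)
    | ih w =>
      rw [← UniformSpace.Completion.coe_smul, hf, hf]
      exact map_smul (TensorProduct.lift φ) c w
  · refine ContinuousLinearMap.opNorm_le_bound _ ψ.opNorm_nonneg fun w => ?_
    induction w using UniformSpace.Completion.induction_on with
    | hp => exact isClosed_le f.continuous.norm (continuous_const.mul continuous_norm)
    | ih w =>
      rw [hf, UniformSpace.Completion.norm_coe]
      exact hle w
  · refine ContinuousLinearMap.opNorm_le_bound₂ _ (norm_nonneg _) fun x y => ?_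
    rw [← hft, mul_assoc]
    exact (f.le_opNorm _).trans (mul_le_mul_of_nonneg_left (norm_nuTmul_le x y) (norm_nonneg _))

theorem hasNormalRepresentableCompletion_nuSeminorm [StarOrderedRing C] [CompleteSpace X]
    (hX : IsNormalRepresentable C X) :
    HasNormalRepresentableCompletion (nuSeminorm C X Y) := by
  have t : IsScalarTower ℂ Cᵐᵒᵖ (NormalProjTensor C X Y) := ⟨fun l c z => by
    obtain ⟨c, rfl⟩ := MulOpposite.op_surjective c
    rw [← MulOpposite.op_smul, op_smul_eq_smul, op_smul_eq_smul, smul_assoc]⟩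
  refine ⟨NormalProjTensor C X Y, inferInstance, inferInstance, inferInstance, inferInstance,
    inferInstance, inferInstance, t, inferInstance, nuCoe C X Y,
    isNormalRepresentable_normalProjTensor hX,
    fun c w => ?_, fun w => ?_, ?_⟩
  · rw [op_smul_eq_smul, op_smul_eq_smul, map_smul]
  · exact UniformSpace.Completion.norm_coe (E := NuTensor C X Y) w
  · exact UniformSpace.Completion.denseRange_coe (α := NuTensor C X Y)

/-- The map `(x, y) ↦ j (x ⊗ y)` is a contraction by the subcross condition, hence a competitor
whose value at `w` is exactly `p w`. -/
theorem le_nuSeminorm_of_hasNormalRepresentableCompletion {p : Seminorm ℂ (X ⊗[C] Y)}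
    (hcross : ∀ (x : X) (y : Y), p (x ⊗ₜ[C] y) ≤ ‖x‖ * ‖y‖)
    (hp : HasNormalRepresentableCompletion p) : p ≤ nuSeminorm C X Y := by
  obtain ⟨W, _, _, _, _, _, _, _, _, j, hW, hj, hjp, -⟩ := hp
  intro w
  refine le_csSup (nuValues_bddAbove w) ⟨W, _, _, ‹_›, _, ‹_›, _, ‹_›, ‹_›,
    (TensorProduct.mk C X Y).compr₂ j, hW, fun c x y => ?_, fun x y => ?_, ?_⟩
  · change j (x ⊗ₜ[C] (MulOpposite.op c • y)) = MulOpposite.op c • j (x ⊗ₜ[C] y)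
    rw [← hj, op_smul_eq_smul, op_smul_eq_smul, TensorProduct.tmul_smul]
  · exact (hjp _).trans_le (hcross x y)
  · have : TensorProduct.lift ((TensorProduct.mk C X Y).compr₂ j) = j :=
      TensorProduct.ext' fun x y => rfl
    rw [this, hjp]

end UniversalProperty

end

theorem mainTheorem9
    {C : Type u} [CommCStarAlgebra C] [PartialOrder C] [StarOrderedRing C]
    -- `C` is an Abelian von Neumann algebra
    {H₀ : Type u} [NormedAddCommGroup H₀] [InnerProductSpace ℂ H₀] [CompleteSpace H₀]
    (N : VonNeumannAlgebra H₀) (e : C ≃⋆ₐ[ℂ] N.toStarSubalgebra)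
    -- `X` and `Y` are central normal representable `C`-bimodules
    {X : Type u} [NormedAddCommGroup X] [NormedSpace ℂ X] [CompleteSpace X]
    [Module C X] [IsScalarTower ℂ C X] [Module Cᵐᵒᵖ X] [IsCentralScalar C X]
    (hX : IsNormalRepresentable C X)
    {Y : Type u} [NormedAddCommGroup Y] [NormedSpace ℂ Y] [CompleteSpace Y]
    [Module C Y] [IsScalarTower ℂ C Y] [Module Cᵐᵒᵖ Y] [IsCentralScalar C Y]
    (hY : IsNormalRepresentable C Y) :
    -- the normal projective tensor product is a central normal representable `C`-bimodule
    ((∀ (c : C) (w : NormalProjTensor C X Y), MulOpposite.op c • w = c • w) ∧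
      IsNormalRepresentable C (NormalProjTensor C X Y)) ∧
    -- the universal property
    (∀ (Z : Type u) [NormedAddCommGroup Z] [NormedSpace ℂ Z] [CompleteSpace Z]
      [Module C Z] [IsScalarTower ℂ C Z] [Module Cᵐᵒᵖ Z] [IsCentralScalar C Z],
      IsNormalRepresentable C Z →
      ∀ ψ : X →L[ℂ] Y →L[ℂ] Z,
        (∀ (c : C) (x : X) (y : Y), ψ (c • x) y = c • ψ x y ∧ ψ x (c • y) = c • ψ x y) →
        ∃ f : NormalProjTensor C X Y →L[ℂ] Z,
          (∀ (c : C) (w : NormalProjTensor C X Y), f (c • w) = c • f w) ∧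
          (∀ (x : X) (y : Y), f (nuTmul x y) = ψ x y) ∧
          ‖f‖ = ‖ψ‖ ∧
          ∀ g : NormalProjTensor C X Y →L[ℂ] Z,
            (∀ (c : C) (w : NormalProjTensor C X Y), g (c • w) = c • g w) →
            (∀ (x : X) (y : Y), g (nuTmul x y) = ψ x y) → g = f) ∧
    -- `ν_C` is the largest subcross norm whose completion is a normal representable `C`-bimodule
    IsGreatest
      {p : Seminorm ℂ (X ⊗[C] Y) |
        (∀ w, p w = 0 → w = 0) ∧
        (∀ (x : X) (y : Y), p (x ⊗ₜ[C] y) ≤ ‖x‖ * ‖y‖) ∧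
        HasNormalRepresentableCompletion p}
      (nuSeminorm C X Y) := by
  refine ⟨⟨op_smul_normalProjTensor, isNormalRepresentable_normalProjTensor hX⟩, ?_,
    ⟨eq_zero_of_nuSeminorm_eq_zero N e hX hY, nuSeminorm_tmul_le,
      hasNormalRepresentableCompletion_nuSeminorm hX⟩,
    fun p hp => le_nuSeminorm_of_hasNormalRepresentableCompletion hp.2.1 hp.2.2⟩
  intro Z _ _ _ _ _ _ _ hZ ψ hψ
  obtain ⟨f, hfC, hft, hfn⟩ := exists_normalProjTensor_lift hZ ψ hψ
  exact ⟨f, hfC, hft, hfn, fun g _ hg =>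
    normalProjTensor_hom_ext fun x y => (hg x y).trans (hft x y).symm⟩
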